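/- **Setting.** For $\theta\in\mathbb R$ let $\sigma_\theta$ denote the skew bicharacter $$\sigma_\theta\big((x_1,y_1),(x_2,y_2)\big)=\exp\big(i\pi\theta(x_2y_1-x_1y_2)\big)$$ of $\mathbb Z^2$. On $\ell^2(\mathbb Z^2)$ put $(U_\theta^n a)(m)=\sigma_\theta(m,n)\,a(m+n)$, and for $f\in\ell^1(\mathbb Z^2)$ let $\|f\|_{\mathcal A_\theta}$ be the operator norm of $\sum_{n}f(n)U_\theta^n$ (the norm of the quantum $2$-torus $\mathcal A_\theta$). Let $p\in\mathbb Z$, $q\in\mathbb N\setminus\{0\}$, $d\in q\mathbb N\setminus\{0\}$. Let $z=e^{2i\pi p/q}$, $u=\mathrm{diag}(1,z,\dots,z^{q-1})$, let $v$ be the cyclic shift $ve_j=e_{j-1}$ of $\mathbb C^q$ (indices mod $q$), and let $\rho^{n,m}=e^{i\pi pnm/q}\,u^nv^m\otimes\mathrm{id}_{\mathbb C^{d/q}}$, a unitary $\sigma_{p/q}$-projective representation of $\mathbb Z^2$ on $\mathbb C^d=\mathbb C^q\otimes\mathbb C^{d/q}$. For $\theta\in\mathbb R$ with $\eth=\theta-\frac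 pq\neq0$, for $\xi$ in the space $\mathcal S(\mathbb C^d)$ of $\mathbb C^d$-valued Schwartz functions on $\mathbb R$ and $(n,m)\in\mathbb Z^2$ put $$(\varpi_\theta^{n,m}\xi)(s)=e^{i\pi\eth nm+2i\pi sn}\,\rho^{n,m}\,\xi(s+\eth m),$$ $$\langle\xi,\omega\rangle_\theta(n,m)=\langle\varpi_\theta^{n,m}\xi,\omega\rangle_{L^2(\mathbb R,\mathbb C^d)},\qquad \|\xi\|_\theta=\big\|\langle\xi,\xi\rangle_\theta\big\|_{\mathcal A_\theta}^{1/2}$$ (inner products are linear in the first variable). The Heisenberg module $\mathscr H_\theta^{p,q,d}$ is, as a Banach space, the completion of $\mathcal S(\mathbb C^d)$ for $\|\cdot\|_\theta$; so $\|\xi\|_{\mathscr H_\theta^{p,q,d}}=\|\xi\|_\theta$ for $\xi\in\mathcal S(\mathbb C^d)$. Let $\overline{\mathbb N}=\mathbb N\cup\{\infty\}$ be the one-point compactification of $\mathbb N$. **Proposition.** Fix $p,q,d$ as above. 1. For every $\theta\neq\frac pq$ and all $\xi,\omega\in\mathcal S(\mathbb C^d)$, $\langle\xi,\omega\rangle_\theta\in\ell^1(\mathbb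 Z^2)$, and $\|\cdot\|_\theta$ is a norm on $\mathcal S(\mathbb C^d)$. 2. Let $(\xi_k)_{k\in\overline{\mathbb N}}$ be a family in $\mathcal S(\mathbb C^d)$ such that $(k,t)\in\overline{\mathbb N}\times\mathbb R\mapsto\xi_k(t)$ is jointly continuous and there is $M>0$ with $\|\xi_k^{(s)}(t)\|_{\mathbb C^d}\le\frac{M}{1+t^2}$ for all $k\in\overline{\mathbb N}$, $t\in\mathbb R$, $s\in\{0,1,2\}$. Let $(\theta_k)_{k\in\mathbb N}$ be a real sequence converging to $\theta_\infty$ with $\theta_k-\frac pq\neq0$ for all $k\in\overline{\mathbb N}$. Then $$\lim_{k\to\infty}\|\xi_k\|_{\mathscr H_{\theta_k}^{p,q,d}}=\|\xi_\infty\|_{\mathscr H_{\theta_\infty}^{p,q,d}}.$$ 3. The Heisenberg modules $\big(\mathscr H_\theta^{p,q,d}\big)_{\theta\in\mathbb R\setminus\{p/q\}}$ form a continuous field of Banach spaces over $\mathbb R\setminus\{\frac pq\}$: there is exactly one complex linear subspace $\Gamma$ of $\prod_{\theta\ne p/q}\mathscr H_\theta^{p,q,d}$ that contains the constant sections $\theta\mapsto\xi$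 for all $\xi\in\mathcal S(\mathbb C^d)$ and satisfies: (a) for each $\theta$ the set $\{s(\theta):s\in\Gamma\}$ is dense in $\mathscr H_\theta^{p,q,d}$; (b) for each $s\in\Gamma$ the function $\theta\mapsto\|s(\theta)\|$ is continuous; (c) a section $s$ belongs to $\Gamma$ whenever for each $\theta_0\neq\frac pq$ and each $\varepsilon>0$ there is $s'\in\Gamma$ with $\|s(\theta)-s'(\theta)\|\le\varepsilon$ for all $\theta$ in a neighbourhood of $\theta_0$. -/

import Mathlib

open scoped SchwartzMap Matrix Kronecker Topology
open Filter

noncomputable section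

/-! ### The quantum two-torus norm -/

/-- The skew bicharacter `exp(iπθ(x₂ y₁ - x₁ y₂))` of `ℤ²`. -/
def skewBicharacter (θ : ℝ) (x y : ℤ × ℤ) : ℂ :=
  Complex.exp (Complex.I * Real.pi * θ * ((y.1 : ℂ) * x.2 - (x.1 : ℂ) * y.2))

theorem norm_skewBicharacter (θ : ℝ) (x y : ℤ × ℤ) : ‖skewBicharacter θ x y‖ = 1 := by
  have h : Complex.I * Real.pi * θ * ((y.1 : ℂ) * x.2 - (x.1 : ℂ) * y.2)
      = ((Real.pi * θ * ((y.1 : ℝ) * x.2 - (x.1 : ℝ) * y.2) : ℝ) : ℂ) * Complex.I := by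
    push_cast; ring
  rw [skewBicharacter, h, Complex.norm_exp_ofReal_mul_I]

/-- The Hilbert space `ℓ²(ℤ²)`. -/
abbrev EllTwo : Type := lp (fun _ : ℤ × ℤ => ℂ) 2

theorem memℓp_twistedShift (θ : ℝ) (n : ℤ × ℤ) (a : EllTwo) :
    Memℓp (fun m : ℤ × ℤ => skewBicharacter θ m n * a (m + n)) 2 := by
  have h2 : (0 : ℝ) < (2 : ENNReal).toReal := by norm_num
  rw [memℓp_gen_iff h2]
  have h := (memℓp_gen_iff h2).1 (lp.memℓp a)
  simpa [norm_skewBicharacter, Function.comp_def] using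
    (Equiv.addRight n).summable_iff.2 h

/-- The unitary `(U_θ^n a)(m) = σ_θ(m, n) a(m + n)` on `ℓ²(ℤ²)`. -/
def twistedShift (θ : ℝ) (n : ℤ × ℤ) : EllTwo →ₗᵢ[ℂ] EllTwo where
  toFun a := ⟨fun m => skewBicharacter θ m n * a (m + n), memℓp_twistedShift θ n a⟩
  map_add' a b := by
    ext m
    exact mul_add _ _ _
  map_smul' c a := by
    ext m
    exact mul_left_comm _ _ _
  norm_map' a := by
    have h2 : (0 : ℝ) < (2 : ENNReal).toReal := by norm_num
    rw [lp.norm_eq_tsum_rpow h2, lp.norm_eq_tsum_rpow h2]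
    congr 1
    simpa [norm_skewBicharacter] using
      (Equiv.addRight n).tsum_eq (fun m => ‖a m‖ ^ (2 : ENNReal).toReal)

/-- The operator `π_θ(f) = ∑ₙ f(n) U_θ^n` on `ℓ²(ℤ²)`; the series converges absolutely in operator
norm when `f ∈ ℓ¹(ℤ²)`. -/
def torusRep (θ : ℝ) (f : ℤ × ℤ → ℂ) : EllTwo →L[ℂ] EllTwo :=
  ∑' n : ℤ × ℤ, f n • (twistedShift θ n).toContinuousLinearMap

/-- The norm of the quantum two-torus `𝒜_θ` on `ℓ¹(ℤ²)`. -/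
def torusNorm (θ : ℝ) (f : ℤ × ℤ → ℂ) : ℝ := ‖torusRep θ f‖

/-! ### The finite-dimensional projective representation -/

/-- The root of unity `exp(2iπp/q)`. -/
def rootOfUnity (p : ℤ) (q : ℕ) : ℂ := Complex.exp (2 * Complex.I * Real.pi * p / q)

theorem norm_rootOfUnity (p : ℤ) (q : ℕ) : ‖rootOfUnity p q‖ = 1 := by
  have h : 2 * Complex.I * Real.pi * p / q
      = ((2 * Real.pi * p / q : ℝ) : ℂ) * Complex.I := by
    push_cast; ring
  rw [rootOfUnity, h, Complex.norm_exp_ofReal_mul_I]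

/-- The unitary matrix `u_{p,q} = diag(1, z, …, z^{q-1})`, with `z = exp(2iπp/q)`. -/
def clockMatrix (p : ℤ) (q : ℕ) : Matrix.unitaryGroup (Fin q) ℂ :=
  ⟨Matrix.diagonal fun j : Fin q => rootOfUnity p q ^ (j : ℕ), by
    rw [Matrix.mem_unitaryGroup_iff, Matrix.star_eq_conjTranspose, Matrix.diagonal_conjTranspose,
      Matrix.diagonal_mul_diagonal, ← Matrix.diagonal_one]
    congr 1
    funext j
    simp [← mul_pow, Complex.mul_conj, Complex.normSq_eq_norm_sq, norm_rootOfUnity]⟩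

/-- The cyclic shift matrix `v_q`, with `v_q e_j = e_{j-1}` (indices modulo `q`). -/
def shiftMatrix (q : ℕ) : Matrix.unitaryGroup (Fin q) ℂ :=
  ⟨(finRotate q).permMatrix ℂ, by
    rw [Matrix.mem_unitaryGroup_iff, Matrix.star_eq_conjTranspose, Matrix.conjTranspose_permMatrix,
      ← Matrix.permMatrix_mul]
    simp⟩

/-- The matrix `ρ_{p,q,1}^{n,m} = exp(iπpnm/q) u^n v^m` on `ℂ^q`. -/
def rhoOne (p : ℤ) (q : ℕ) (n : ℤ × ℤ) : Matrix (Fin q) (Fin q) ℂ :=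
  Complex.exp (Complex.I * Real.pi * p * n.1 * n.2 / q) •
    ((clockMatrix p q ^ n.1 * shiftMatrix q ^ n.2 : Matrix.unitaryGroup (Fin q) ℂ) :
      Matrix (Fin q) (Fin q) ℂ)

/-- The identification of the index set of `ℂ^d` with that of `ℂ^q ⊗ ℂ^{d/q}`. -/
def blockEquiv {q d : ℕ} (hqd : q ∣ d) : Fin d ≃ Fin q × Fin (d / q) :=
  (finCongr (Nat.mul_div_cancel' hqd).symm).trans finProdFinEquiv.symm

/-- The matrix `ρ_{p,q,d}^{n,m} = ρ_{p,q,1}^{n,m} ⊗ id` on `ℂ^d = ℂ^q ⊗ ℂ^{d/q}`. -/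
def rho (p : ℤ) {q d : ℕ} (hqd : q ∣ d) (n : ℤ × ℤ) : Matrix (Fin d) (Fin d) ℂ :=
  (rhoOne p q n ⊗ₖ (1 : Matrix (Fin (d / q)) (Fin (d / q)) ℂ)).submatrix
    (blockEquiv hqd) (blockEquiv hqd)

theorem rootOfUnity_pow (p : ℤ) {q : ℕ} (hq : q ≠ 0) : rootOfUnity p q ^ q = 1 := by
  have hq' : (q : ℂ) ≠ 0 := by exact_mod_cast hq
  rw [rootOfUnity, ← Complex.exp_nat_mul, Complex.exp_eq_one_iff]
  exact ⟨p, by field_simp⟩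

theorem shift_mul_clock (p : ℤ) (q : ℕ) :
    (shiftMatrix q : Matrix (Fin q) (Fin q) ℂ) * (clockMatrix p q : Matrix (Fin q) (Fin q) ℂ)
      = rootOfUnity p q • ((clockMatrix p q : Matrix (Fin q) (Fin q) ℂ)
          * (shiftMatrix q : Matrix (Fin q) (Fin q) ℂ)) := by
  ext i j
  simp only [shiftMatrix, clockMatrix, Matrix.smul_apply, Matrix.diagonal_mul, Matrix.mul_diagonal,
    smul_eq_mul, Equiv.Perm.permMatrix, PEquiv.toMatrix_apply, Equiv.toPEquiv_apply,
    Option.mem_def, Option.some.injEq]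
  split_ifs with hij
  · subst hij
    obtain ⟨k, rfl⟩ : ∃ k, q = k + 1 := ⟨q - 1, by have := i.2; omega⟩
    by_cases hi : i = Fin.last k
    · subst hi
      simp only [finRotate_last, Fin.val_zero, Fin.val_last, pow_zero, mul_one]
      rw [← pow_succ', rootOfUnity_pow p (Nat.succ_ne_zero k)]
    · rw [coe_finRotate_of_ne_last hi, pow_succ']
      ring
  · simp

/-- `ρ_{p,q,1}` is a projective representation of `ℤ²` with cocycle `σ_{p/q}`. -/
theorem rhoOne_mul (p : ℤ) (q : ℕ) (x y : ℤ × ℤ) :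
    rhoOne p q x * rhoOne p q y = skewBicharacter (p / q) x y • rhoOne p q (x + y) := by
  set u := clockMatrix p q with hu
  set v := shiftMatrix q with hv
  let z : Matrix.unitaryGroup (Fin q) ℂ := ⟨rootOfUnity p q • 1, by
    rw [Matrix.mem_unitaryGroup_iff, star_smul, star_one, smul_mul_smul_comm, mul_one]
    simp [Complex.mul_conj, Complex.normSq_eq_norm_sq, norm_rootOfUnity]⟩
  have hz : ∀ w : Matrix.unitaryGroup (Fin q) ℂ, Commute z w := fun w => by
    apply Subtype.ext
    simp [z]
  have hzpow : ∀ k : ℤ, ((z ^ k : Matrix.unitaryGroup (Fin q) ℂ) : Matrix (Fin q) (Fin q) ℂ)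
      = (rootOfUnity p q ^ k) • 1 := by
    have hr : rootOfUnity p q ≠ 0 := Complex.exp_ne_zero _
    have hn : ∀ k : ℕ, ((z ^ k : Matrix.unitaryGroup (Fin q) ℂ) : Matrix (Fin q) (Fin q) ℂ)
        = (rootOfUnity p q ^ k) • 1 := fun k => by
      simp [z, smul_pow]
    have hstar : ∀ k : ℕ, star (rootOfUnity p q ^ k) = (rootOfUnity p q ^ k)⁻¹ := fun k => by
      rw [Complex.inv_def]
      simp [Complex.normSq_eq_norm_sq, norm_rootOfUnity]
    intro k
    obtain ⟨k, rfl | rfl⟩ := k.eq_nat_or_neg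
    · simpa using hn k
    · rw [zpow_neg, zpow_natCast, Matrix.UnitaryGroup.inv_val, hn, star_smul, star_one, hstar,
        zpow_neg, zpow_natCast]
  have hvu : v * u = z * (u * v) := by
    apply Subtype.ext
    simpa [z] using shift_mul_clock p q
  have h1 : ∀ n : ℤ, v * u ^ n * v⁻¹ = z ^ n * u ^ n := fun n => by
    rw [← conj_zpow, hvu, ← (hz u).mul_zpow]
    congr 1
    group
  have h2 : ∀ n m : ℤ, v ^ m * u ^ n = z ^ (n * m) * (u ^ n * v ^ m) := fun n m => by
    have h3 : (u ^ n)⁻¹ * v * u ^ n = z ^ n * v := by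
      have := h1 n
      rw [mul_inv_eq_iff_eq_mul] at this
      rw [mul_assoc, this, ← mul_assoc, ← mul_assoc, ((hz ((u ^ n)⁻¹)).zpow_left n).symm.eq]
      group
    have h4 : (u ^ n)⁻¹ * v ^ m * u ^ n = z ^ (n * m) * v ^ m := by
      have := conj_zpow (b := v) (a := (u ^ n)⁻¹) (i := m)
      simp only [inv_inv] at this
      rw [← this, h3, ((hz v).zpow_left n).mul_zpow, ← zpow_mul]
    have h5 := congrArg (fun w => u ^ n * w) h4
    simp only [← mul_assoc, mul_inv_cancel, one_mul] at h5
    rw [h5, ← ((hz (u ^ n)).zpow_left _).eq, mul_assoc]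
  have h6 : u ^ x.1 * v ^ x.2 * (u ^ y.1 * v ^ y.2)
      = z ^ (y.1 * x.2) * (u ^ (x.1 + y.1) * v ^ (x.2 + y.2)) := by
    calc u ^ x.1 * v ^ x.2 * (u ^ y.1 * v ^ y.2)
        = u ^ x.1 * (v ^ x.2 * u ^ y.1) * v ^ y.2 := by group
      _ = u ^ x.1 * z ^ (y.1 * x.2) * (u ^ y.1 * v ^ x.2) * v ^ y.2 := by
        rw [h2]; simp only [mul_assoc]
      _ = z ^ (y.1 * x.2) * u ^ x.1 * (u ^ y.1 * v ^ x.2) * v ^ y.2 := by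
        rw [← ((hz (u ^ x.1)).zpow_left _).eq]
      _ = _ := by rw [zpow_add, zpow_add]; simp only [mul_assoc]
  have h7 := congrArg (Subtype.val : Matrix.unitaryGroup (Fin q) ℂ → Matrix (Fin q) (Fin q) ℂ) h6
  rw [rhoOne, rhoOne, rhoOne, smul_mul_smul_comm]
  rw [show ((u ^ x.1 * v ^ x.2 : Matrix.unitaryGroup (Fin q) ℂ) : Matrix (Fin q) (Fin q) ℂ)
      * ((u ^ y.1 * v ^ y.2 : Matrix.unitaryGroup (Fin q) ℂ) : Matrix (Fin q) (Fin q) ℂ) = _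
    from h7, Matrix.UnitaryGroup.mul_val, hzpow, smul_mul_assoc, one_mul, smul_smul, smul_smul,
    Prod.fst_add, Prod.snd_add]
  congr 1
  rw [rootOfUnity, skewBicharacter, ← Complex.exp_int_mul, ← Complex.exp_add, ← Complex.exp_add,
    ← Complex.exp_add]
  congr 1
  push_cast
  ring

/-! ### Heisenberg modules -/

/-- The operator `ϖ^{n,m} = σ_{ð,1}^{n,m} ⊗ ρ_{p,q,d}^{n,m}` with `ð = θ - p/q`, on functions from
`ℝ` to `ℂ^d`, where `(σ_{ð,1}^{n,m} ξ)(s) = exp(iπðnm + 2iπsn) ξ(s + ðm)`. -/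
def varpi (p : ℤ) {q d : ℕ} (hqd : q ∣ d) (θ : ℝ) (n : ℤ × ℤ)
    (ξ : ℝ → EuclideanSpace ℂ (Fin d)) (s : ℝ) : EuclideanSpace ℂ (Fin d) :=
  Complex.exp (Complex.I * Real.pi * (θ - p / q) * n.1 * n.2 + 2 * Complex.I * Real.pi * s * n.1) •
    Matrix.toEuclideanLin (rho p hqd n) (ξ (s + (θ - p / q) * n.2))

/-- The inner product `(n,m) ↦ ⟨ϖ^{n,m} ξ, ω⟩` of the Heisenberg module, where the inner product of
`L²(ℝ) ⊗ ℂ^d = L²(ℝ, ℂ^d)` is linear in `ϖ^{n,m} ξ` and conjugate-linear in `ω`. -/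
def heisenbergInner (p : ℤ) {q d : ℕ} (hqd : q ∣ d) (θ : ℝ)
    (ξ ω : 𝓢(ℝ, EuclideanSpace ℂ (Fin d))) (n : ℤ × ℤ) : ℂ :=
  ∫ s : ℝ, inner ℂ (ω s) (varpi p hqd θ n ξ s)

/-- The norm of the Heisenberg module on Schwartz functions, `‖⟨ξ, ξ⟩‖_{𝒜_θ}^{1/2}`. -/
def heisenbergNorm (p : ℤ) {q d : ℕ} (hqd : q ∣ d) (θ : ℝ)
    (ξ : 𝓢(ℝ, EuclideanSpace ℂ (Fin d))) : ℝ :=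
  √(torusNorm θ (heisenbergInner p hqd θ ξ ξ))

/-- The space of `ℂ^d`-valued Schwartz functions, carrying the function `heisenbergNorm` instead of
its usual topology. -/
def PreHeisenbergModule (_p : ℤ) {q d : ℕ} (_hqd : q ∣ d) (_θ : ℝ) : Type :=
  𝓢(ℝ, EuclideanSpace ℂ (Fin d))

namespace PreHeisenbergModule

variable (p : ℤ) {q d : ℕ} (hqd : q ∣ d) (θ : ℝ)

instance : AddCommGroup (PreHeisenbergModule p hqd θ) :=
  inferInstanceAs (AddCommGroup 𝓢(ℝ, EuclideanSpace ℂ (Fin d)))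

instance : Module ℂ (PreHeisenbergModule p hqd θ) :=
  inferInstanceAs (Module ℂ 𝓢(ℝ, EuclideanSpace ℂ (Fin d)))

instance : Norm (PreHeisenbergModule p hqd θ) := ⟨heisenbergNorm p hqd θ⟩

end PreHeisenbergModule

/-- `heisenbergNorm` is a norm on the complex vector space of Schwartz functions. -/
abbrev IsHeisenbergNorm (p : ℤ) {q d : ℕ} (hqd : q ∣ d) (θ : ℝ) : Prop :=
  NormedSpace.Core ℂ (PreHeisenbergModule p hqd θ)

section HeisenbergModule

variable {p : ℤ} {q d : ℕ} {hqd : q ∣ d} {θ : ℝ}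

/-- The space of Schwartz functions normed by `heisenbergNorm`, once the latter is known to be a
norm. -/
def NormedPreHeisenbergModule (_h : IsHeisenbergNorm p hqd θ) : Type :=
  PreHeisenbergModule p hqd θ

instance (h : IsHeisenbergNorm p hqd θ) : NormedAddCommGroup (NormedPreHeisenbergModule h) :=
  NormedAddCommGroup.ofCore (𝕜 := ℂ) (E := PreHeisenbergModule p hqd θ) h

instance (h : IsHeisenbergNorm p hqd θ) : Module ℂ (NormedPreHeisenbergModule h) :=
  inferInstanceAs (Module ℂ (PreHeisenbergModule p hqd θ))

instance (h : IsHeisenbergNorm p hqd θ) : NormedSpace ℂ (NormedPreHeisenbergModule h) where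
  norm_smul_le c ξ := (h.norm_smul c ξ).le

/-- The Heisenberg module, as a Banach space: the completion of the space of Schwartz functions for
`heisenbergNorm`. -/
abbrev HeisenbergModule (h : IsHeisenbergNorm p hqd θ) : Type :=
  UniformSpace.Completion (NormedPreHeisenbergModule h)

/-- The canonical map from Schwartz functions to the Heisenberg module. -/
def HeisenbergModule.ofSchwartz (h : IsHeisenbergNorm p hqd θ)
    (ξ : 𝓢(ℝ, EuclideanSpace ℂ (Fin d))) : HeisenbergModule h :=
  UniformSpace.Completion.coe' (α := NormedPreHeisenbergModule h) ξ

theorem HeisenbergModule.norm_ofSchwartz (h : IsHeisenbergNorm p hqd θ)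
    (ξ : 𝓢(ℝ, EuclideanSpace ℂ (Fin d))) : ‖ofSchwartz h ξ‖ = heisenbergNorm p hqd θ ξ :=
  UniformSpace.Completion.norm_coe (E := NormedPreHeisenbergModule h) ξ

end HeisenbergModule

/-! ### Continuous fields of Banach spaces -/

/-- A family `(E x)` of Banach spaces over a topological space `X` with a linear space `Γ` of
sections is a continuous field of Banach spaces. -/
structure IsContinuousField {X : Type*} [TopologicalSpace X] {E : X → Type*}
    [∀ x, NormedAddCommGroup (E x)] [∀ x, NormedSpace ℂ (E x)] [∀ x, CompleteSpace (E x)]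
    (Γ : Submodule ℂ (∀ x, E x)) : Prop where
  dense_eval : ∀ x, Dense {e : E x | ∃ s ∈ Γ, s x = e}
  continuous_norm : ∀ s ∈ Γ, Continuous fun x => ‖s x‖
  mem_of_locally_approx : ∀ s : ∀ x, E x,
    (∀ x, ∀ ε > 0, ∃ s' ∈ Γ, ∀ᶠ y in 𝓝 x, ‖s y - s' y‖ ≤ ε) → s ∈ Γ

end

noncomputable section

/-! ### Algebra of the skew bicharacter -/

/-! The norm of `𝒜_θ` is the norm of the matrix `f(m-k) σ_θ(m,k)` on `ℓ²(ℤ²)`. Two facts about such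
matrices carry the proof.

For `f = ⟨ξ,ξ⟩_θ` the matrix is a Gram matrix of the vectors `ϖ^m ξ` in `L²`, so `‖ξ‖_θ` is the norm
of the synthesis map `c ↦ ∑ c(m) ϖ^m ξ`. This map is linear in `ξ`, whence the triangle inequality;
`c = δ₀` gives definiteness (`norm_sum_varpiLp_le`, `heisenbergNorm_le_of_norm_sum_varpiLp_le`).

For continuity in `θ`, the kernel `exp(-π|η||m-k|²/2) σ_η(m,k)` is a Gram matrix of unit vectors,
namely coherent states of Fock space. Schur multiplication by such a kernel is contractive, and it
moves the angle from `θ` to `θ + η` at the price of a Gaussian factor on `f`. That factor tends to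
`1` as `η → 0`, so for `f ∈ ℓ¹` the norm is continuous in the angle
(`torusNorm_gaussianMultiplier_le`, `tendsto_torusNorm`).

Integrating by parts twice bounds `⟨ξ,ξ⟩_θ` by one summable function for all `θ` near a given angle,
so dominated convergence gives continuity of the Heisenberg norms. The continuous field is then the
locally uniform closure of the constant sections. -/

theorem skewBicharacter_mul_angle (θ η : ℝ) (x y : ℤ × ℤ) :
    skewBicharacter θ x y * skewBicharacter η x y = skewBicharacter (θ + η) x y := by
  simp only [skewBicharacter, ← Complex.exp_add]
  congr 1
  push_cast
  ring

theorem skewBicharacter_neg_sub (θ : ℝ) (m k : ℤ × ℤ) :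
    skewBicharacter θ (-m) (m - k) = skewBicharacter θ m k := by
  simp only [skewBicharacter, Prod.fst_neg, Prod.snd_neg, Prod.fst_sub, Prod.snd_sub]
  congr 1
  push_cast
  ring

theorem conj_skewBicharacter (θ : ℝ) (x y : ℤ × ℤ) :
    starRingEnd ℂ (skewBicharacter θ x y) = skewBicharacter θ y x := by
  simp only [skewBicharacter, ← Complex.exp_conj]
  congr 1
  simp only [map_mul, map_sub, Complex.conj_I, Complex.conj_ofReal, map_intCast]
  ring

theorem skewBicharacter_mul_swap (θ : ℝ) (x y : ℤ × ℤ) :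
    skewBicharacter θ x y * skewBicharacter θ y x = 1 := by
  rw [← conj_skewBicharacter θ x y, Complex.mul_conj, Complex.normSq_eq_norm_sq,
    norm_skewBicharacter]
  simp

/-! ### The quantum torus norm -/

theorem summable_torusRep (θ : ℝ) {f : ℤ × ℤ → ℂ} (hf : Summable fun n => ‖f n‖) :
    Summable fun n => f n • (twistedShift θ n).toContinuousLinearMap := by
  refine Summable.of_norm_bounded hf fun n => ?_
  rw [norm_smul]
  exact mul_le_of_le_one_right (norm_nonneg _) (twistedShift θ n).norm_toContinuousLinearMap_le

theorem torusNorm_nonneg (θ : ℝ) (f : ℤ × ℤ → ℂ) : 0 ≤ torusNorm θ f := norm_nonneg _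

theorem abs_torusNorm_sub_le (θ : ℝ) {f g : ℤ × ℤ → ℂ} (hf : Summable fun n => ‖f n‖)
    (hg : Summable fun n => ‖g n‖) :
    |torusNorm θ f - torusNorm θ g| ≤ ∑' n, ‖f n - g n‖ := by
  have hs : Summable fun n => ‖f n - g n‖ :=
    Summable.of_nonneg_of_le (fun _ => norm_nonneg _) (fun n => norm_sub_le _ _) (hf.add hg)
  refine (abs_norm_sub_norm_le _ _).trans ?_
  rw [torusRep, torusRep, ← (summable_torusRep θ hf).tsum_sub (summable_torusRep θ hg)]
  refine tsum_of_norm_bounded hs.hasSum fun n => ?_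
  rw [← sub_smul, norm_smul]
  exact mul_le_of_le_one_right (norm_nonneg _) (twistedShift θ n).norm_toContinuousLinearMap_le

theorem torusNorm_const_mul (θ : ℝ) (c : ℂ) (f : ℤ × ℤ → ℂ) :
    torusNorm θ (fun n => c * f n) = ‖c‖ * torusNorm θ f := by
  rw [torusNorm, torusNorm, torusRep, torusRep, ← norm_smul, ← tsum_const_smul'']
  simp only [smul_smul]

/-- The finitely supported sequence `∑ₖ a(k) δ₋ₖ`. -/
def reflectedVector (S : Finset (ℤ × ℤ)) (a : ℤ × ℤ → ℂ) : EllTwo :=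
  ∑ k ∈ S, lp.single 2 (-k) (a k)

theorem norm_reflectedVector_sq (S : Finset (ℤ × ℤ)) (a : ℤ × ℤ → ℂ) :
    ‖reflectedVector S a‖ ^ 2 = ∑ k ∈ S, ‖a k‖ ^ 2 := by
  have h := lp.norm_sum_single (E := fun _ : ℤ × ℤ => ℂ) (p := 2) (by norm_num)
    (fun i => a (-i)) (S.map (Equiv.neg _).toEmbedding)
  simpa [reflectedVector] using h

theorem tendsto_reflectedVector (x : EllTwo) :
    Tendsto (fun S => reflectedVector S fun k => x (-k)) atTop (𝓝 x) :=
  (Equiv.neg (ℤ × ℤ)).hasSum_iff.2 (lp.hasSum_single (p := 2) (by norm_num) x)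

theorem sum_norm_sq_le (S : Finset (ℤ × ℤ)) (x : EllTwo) :
    ∑ k ∈ S, ‖x (-k)‖ ^ 2 ≤ ‖x‖ ^ 2 := by
  have h := lp.sum_rpow_le_norm_rpow (p := 2) (by norm_num) x (S.map (Equiv.neg _).toEmbedding)
  simpa using h

/-- The sesquilinear form `∑ f(m-k) σ_θ(m,k) a(k) conj b(m)`. -/
def twistedForm (θ : ℝ) (f : ℤ × ℤ → ℂ) (S : Finset (ℤ × ℤ)) (a b : ℤ × ℤ → ℂ) : ℂ :=
  ∑ m ∈ S, ∑ k ∈ S, f (m - k) * skewBicharacter θ m k * (a k * starRingEnd ℂ (b m))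

/-- Only `n = m - k` contributes to the series. The reflected indices `-m`, `-k` turn the phase into
`σ_θ(m,k)`, the cocycle that also appears in inner products of the vectors `ϖ^m ξ`. -/
theorem inner_single_torusRep (θ : ℝ) {f : ℤ × ℤ → ℂ} (hf : Summable fun n => ‖f n‖)
    (m k : ℤ × ℤ) (c e : ℂ) :
    inner ℂ (lp.single 2 (-m) e : EllTwo) (torusRep θ f (lp.single 2 (-k) c))
      = f (m - k) * skewBicharacter θ m k * (c * starRingEnd ℂ e) := by
  have h := (summable_torusRep θ hf).hasSum.mapL
    ((innerSL ℂ (lp.single 2 (-m) e : EllTwo)).comp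
      (ContinuousLinearMap.apply ℂ EllTwo (lp.single 2 (-k) c : EllTwo)))
  refine h.unique ?_
  convert hasSum_single (m - k) ?_ using 1
  · simp only [ContinuousLinearMap.comp_apply, ContinuousLinearMap.apply_apply,
      innerSL_apply_apply, smul_apply, inner_smul_right,
      lp.inner_single_left, LinearIsometry.coe_toContinuousLinearMap]
    change _ = f (m - k) * ((skewBicharacter θ (-m) (m - k) *
      (lp.single 2 (-k) c : EllTwo) (-m + (m - k))) * starRingEnd ℂ e)
    rw [skewBicharacter_neg_sub, show -m + (m - k) = -k by abel, lp.single_apply_self]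
    ring
  · intro n hn
    simp only [ContinuousLinearMap.comp_apply, ContinuousLinearMap.apply_apply,
      innerSL_apply_apply, smul_apply, inner_smul_right,
      lp.inner_single_left, LinearIsometry.coe_toContinuousLinearMap]
    change f n * ((skewBicharacter θ (-m) n *
      (lp.single 2 (-k) c : EllTwo) (-m + n)) * starRingEnd ℂ e) = 0
    rw [lp.single_apply_ne _ _ _ (fun h => hn ?_)]
    · simp
    · rw [sub_eq_add_neg, ← h]; abel

theorem inner_reflectedVector_torusRep (θ : ℝ) {f : ℤ × ℤ → ℂ} (hf : Summable fun n => ‖f n‖)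
    (S : Finset (ℤ × ℤ)) (a b : ℤ × ℤ → ℂ) :
    inner ℂ (reflectedVector S b) (torusRep θ f (reflectedVector S a)) = twistedForm θ f S a b := by
  simp only [reflectedVector, map_sum, sum_inner, inner_sum, inner_single_torusRep θ hf,
    twistedForm]
  exact Finset.sum_comm

/-- Cauchy–Schwarz followed by the arithmetic-geometric mean inequality. Unlike a product of norms,
the mean of squares is additive, so the bound can be summed over the coordinates of a Gram
decomposition. -/
theorem norm_twistedForm_le (θ : ℝ) {f : ℤ × ℤ → ℂ} (hf : Summable fun n => ‖f n‖)
    (S : Finset (ℤ × ℤ)) (a b : ℤ × ℤ → ℂ) :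
    ‖twistedForm θ f S a b‖
      ≤ torusNorm θ f * ((∑ k ∈ S, ‖a k‖ ^ 2 + ∑ k ∈ S, ‖b k‖ ^ 2) / 2) := by
  rw [← inner_reflectedVector_torusRep θ hf, ← norm_reflectedVector_sq, ← norm_reflectedVector_sq]
  set x := reflectedVector S a
  set y := reflectedVector S b
  calc ‖inner ℂ y (torusRep θ f x)‖ ≤ ‖y‖ * ‖torusRep θ f x‖ := norm_inner_le_norm _ _
    _ ≤ ‖y‖ * (torusNorm θ f * ‖x‖) := by gcongr; exact (torusRep θ f).le_opNorm x
    _ = torusNorm θ f * (‖x‖ * ‖y‖) := by ring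
    _ ≤ _ := by
      gcongr
      · exact torusNorm_nonneg θ f
      · nlinarith [sq_nonneg (‖x‖ - ‖y‖)]

/-- Testing against `y = (‖x‖ / ‖T x‖) T x`, which has the same norm as `x`, loses nothing in the
arithmetic-geometric mean inequality. -/
theorem opNorm_le_of_norm_inner_le {E : Type*} [NormedAddCommGroup E] [InnerProductSpace ℂ E]
    (T : E →L[ℂ] E) {C : ℝ} (hC : 0 ≤ C)
    (h : ∀ x y : E, ‖inner ℂ y (T x)‖ ≤ C * ((‖x‖ ^ 2 + ‖y‖ ^ 2) / 2)) : ‖T‖ ≤ C := by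
  refine T.opNorm_le_bound hC fun x => ?_
  rcases (norm_nonneg x).eq_or_lt with hx | hx
  · rw [eq_comm, norm_eq_zero] at hx
    simp [hx]
  rcases (norm_nonneg (T x)).eq_or_lt with hy | hy
  · rw [← hy]; positivity
  have h1 := h x (((‖x‖ / ‖T x‖ : ℝ) : ℂ) • T x)
  rw [inner_smul_left, inner_self_eq_norm_sq_to_K, norm_smul] at h1
  have h2 : ‖((‖x‖ / ‖T x‖ : ℝ) : ℂ)‖ = ‖x‖ / ‖T x‖ := by
    rw [Complex.norm_real, Real.norm_of_nonneg (by positivity)]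
  rw [norm_mul, RCLike.norm_conj, norm_pow, h2] at h1
  simp only [Complex.coe_algebraMap, Complex.norm_real, norm_norm] at h1
  rw [div_mul_cancel₀ _ hy.ne'] at h1
  have h3 : ‖x‖ / ‖T x‖ * ‖T x‖ ^ 2 = ‖x‖ * ‖T x‖ := by field_simp
  rw [h3] at h1
  have : ‖x‖ * ‖T x‖ ≤ ‖x‖ * (C * ‖x‖) := by linarith
  exact le_of_mul_le_mul_left this hx

theorem torusNorm_le_of_twistedForm_le (θ : ℝ) {f : ℤ × ℤ → ℂ} (hf : Summable fun n => ‖f n‖)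
    {C : ℝ} (hC : 0 ≤ C)
    (h : ∀ S a b, ‖twistedForm θ f S a b‖
      ≤ C * ((∑ k ∈ S, ‖a k‖ ^ 2 + ∑ k ∈ S, ‖b k‖ ^ 2) / 2)) :
    torusNorm θ f ≤ C := by
  refine opNorm_le_of_norm_inner_le _ hC fun x y => ?_
  have ht : Tendsto (fun S => ‖inner ℂ (reflectedVector S fun k => y (-k))
      (torusRep θ f (reflectedVector S fun k => x (-k)))‖) atTop
      (𝓝 ‖inner ℂ y (torusRep θ f x)‖) :=
    ((tendsto_reflectedVector y).inner
      (((torusRep θ f).continuous.tendsto x).comp (tendsto_reflectedVector x))).norm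
  refine le_of_tendsto ht (Eventually.of_forall fun S => ?_)
  rw [inner_reflectedVector_torusRep θ hf]
  refine (h S _ _).trans ?_
  gcongr
  · exact sum_norm_sq_le S x
  · exact sum_norm_sq_le S y

/-! ### Continuity of the quantum torus norm in the deformation parameter -/

/-- The Gaussian multiplier `exp(-π|η||n|²/2)`. -/
def gaussianMultiplier (η : ℝ) (n : ℤ × ℤ) : ℝ :=
  Real.exp (-(Real.pi * |η| * ((n.1 : ℝ) ^ 2 + (n.2 : ℝ) ^ 2) / 2))

theorem gaussianMultiplier_nonneg (η : ℝ) (n : ℤ × ℤ) : 0 ≤ gaussianMultiplier η n :=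
  (Real.exp_pos _).le

theorem gaussianMultiplier_le_one (η : ℝ) (n : ℤ × ℤ) : gaussianMultiplier η n ≤ 1 := by
  rw [gaussianMultiplier, Real.exp_le_one_iff, neg_nonpos]
  positivity

/-- The coordinates of the coherent state of Fock space at `z`. -/
def coherentCoeff (z : ℂ) (j : ℕ) : ℂ :=
  Complex.exp (-(‖z‖ ^ 2 / 2 : ℝ)) * (z ^ j / (√(j.factorial : ℝ) : ℝ))

/-- The exponential series of `z * conj w`, normalized by the two Gaussian factors. For `z = w` the
exponent vanishes, so coherent states are unit vectors. -/
theorem hasSum_coherentCoeff (z w : ℂ) :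
    HasSum (fun j => coherentCoeff z j * starRingEnd ℂ (coherentCoeff w j))
      (Complex.exp (z * starRingEnd ℂ w - (‖z‖ ^ 2 / 2 : ℝ) - (‖w‖ ^ 2 / 2 : ℝ))) := by
  have h := NormedSpace.expSeries_div_hasSum_exp (z * starRingEnd ℂ w)
  rw [← Complex.exp_eq_exp_ℂ] at h
  convert! h.mul_left (Complex.exp (-(‖z‖ ^ 2 / 2 : ℝ)) * Complex.exp (-(‖w‖ ^ 2 / 2 : ℝ))) using 1
  · funext j
    have hj : ((√(j.factorial : ℝ) : ℝ) : ℂ) * ((√(j.factorial : ℝ) : ℝ) : ℂ) = j.factorial := by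
      rw [← Complex.ofReal_mul, Real.mul_self_sqrt (by positivity), Complex.ofReal_natCast]
    rw [coherentCoeff, coherentCoeff, ← hj]
    simp only [map_mul, map_div₀, map_pow, Complex.conj_ofReal, ← Complex.exp_conj, map_neg,
      mul_pow]
    ring
  · rw [← Complex.exp_add, ← Complex.exp_add]
    congr 1
    ring

theorem hasSum_norm_coherentCoeff_sq (z : ℂ) : HasSum (fun j => ‖coherentCoeff z j‖ ^ 2) 1 := by
  have h := hasSum_coherentCoeff z z
  simp only [Complex.mul_conj, Complex.normSq_eq_norm_sq] at h
  rw [show ((‖z‖ ^ 2 : ℝ) : ℂ) - (‖z‖ ^ 2 / 2 : ℝ) - (‖z‖ ^ 2 / 2 : ℝ) = 0 by push_cast; ring,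
    Complex.exp_zero] at h
  exact Complex.hasSum_ofReal.1 (by simpa using h)

/-- The kernel `exp(-π|η||m-k|²/2) σ_η(m,k)` is the Gram matrix of a family of unit vectors. -/
theorem exists_hasSum_gaussianMultiplier (η : ℝ) : ∃ x : ℤ × ℤ → ℕ → ℂ,
    (∀ k, HasSum (fun j => ‖x k j‖ ^ 2) 1) ∧
    ∀ m k, HasSum (fun j => x k j * starRingEnd ℂ (x m j))
      (gaussianMultiplier η (m - k) * skewBicharacter η m k) := by
  -- With `z k = r k₁ + i t k₂`, equal squares `r² = t²` make `|z k - z m|²` a multiple of `|k -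
  -- m|²`, while the relative sign of `r` and `t` gives `Im (z k * conj (z m))` the sign required by
  -- `σ_η(m,k)`.
  obtain ⟨r, t, hr, ht, hrt⟩ : ∃ r t : ℝ, r ^ 2 = Real.pi * |η| ∧ t ^ 2 = Real.pi * |η| ∧
      r * t = -(Real.pi * η) := by
    have h0 : √(Real.pi * |η|) ^ 2 = Real.pi * |η| := Real.sq_sqrt (by positivity)
    rcases le_total 0 η with hη | hη
    · refine ⟨√(Real.pi * |η|), -√(Real.pi * |η|), h0, by rw [neg_sq, h0], ?_⟩
      rw [mul_neg, ← sq, h0, abs_of_nonneg hη]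
    · refine ⟨√(Real.pi * |η|), √(Real.pi * |η|), h0, h0, ?_⟩
      rw [← sq, h0, abs_of_nonpos hη]
      ring
  let z : ℤ × ℤ → ℂ := fun k => (r * k.1 : ℝ) + (t * k.2 : ℝ) * Complex.I
  have hz : ∀ k, ‖z k‖ ^ 2 = Real.pi * |η| * ((k.1 : ℝ) ^ 2 + (k.2 : ℝ) ^ 2) := fun k => by
    rw [← Complex.normSq_eq_norm_sq, Complex.normSq_add_mul_I, mul_pow, mul_pow, hr, ht]
    ring
  refine ⟨fun k => coherentCoeff (z k), fun k => hasSum_norm_coherentCoeff_sq (z k), fun m k => ?_⟩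
  convert hasSum_coherentCoeff (z k) (z m) using 1
  rw [hz, hz, gaussianMultiplier, skewBicharacter, Complex.ofReal_exp, ← Complex.exp_add]
  congr 1
  have hr' : (r : ℂ) ^ 2 = Real.pi * (|η| : ℝ) := by exact_mod_cast hr
  have ht' : (t : ℂ) ^ 2 = Real.pi * (|η| : ℝ) := by exact_mod_cast ht
  have hrt' : (r : ℂ) * t = -(Real.pi * η) := by exact_mod_cast hrt
  simp only [z, map_add, map_mul, Complex.conj_ofReal, Complex.conj_I, Prod.fst_sub, Prod.snd_sub]
  push_cast
  linear_combination -((k.1 : ℂ) * m.1) * hr' - (k.2 : ℂ) * m.2 * ht'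
    - Complex.I * (k.2 * m.1 - k.1 * m.2) * hrt' + t ^ 2 * (k.2 * m.2 : ℂ) * Complex.I_sq

/-- Contractivity of a Schur multiplier given by unit vectors `x k`: the form at angle `θ + η` is
the sum over `j` of the forms at angle `θ` in `a k * x k j` and `b k * x k j`, and summing the
squared norms of these over `j` returns those of `a` and `b`. -/
theorem torusNorm_gaussianMultiplier_le (θ η : ℝ) {f : ℤ × ℤ → ℂ}
    (hf : Summable fun n => ‖f n‖) :
    torusNorm (θ + η) (fun n => f n * gaussianMultiplier η n) ≤ torusNorm θ f := by
  have hs : Summable fun n => ‖f n * gaussianMultiplier η n‖ := by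
    refine Summable.of_nonneg_of_le (fun _ => norm_nonneg _) (fun n => ?_) hf
    rw [norm_mul, Complex.norm_real, Real.norm_of_nonneg (gaussianMultiplier_nonneg η n)]
    exact mul_le_of_le_one_right (norm_nonneg _) (gaussianMultiplier_le_one η n)
  refine torusNorm_le_of_twistedForm_le _ hs (torusNorm_nonneg θ f) fun S a b => ?_
  obtain ⟨x, hx1, hx⟩ := exists_hasSum_gaussianMultiplier η
  have hsum : HasSum (fun j => twistedForm θ f S (fun k => a k * x k j) (fun k => b k * x k j))
      (twistedForm (θ + η) (fun n => f n * gaussianMultiplier η n) S a b) := by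
    refine hasSum_sum fun m _ => hasSum_sum fun k _ => ?_
    convert! (hx m k).mul_left (f (m - k) * skewBicharacter θ m k *
      (a k * starRingEnd ℂ (b m))) using 1
    · funext j
      rw [map_mul]
      ring
    · rw [← skewBicharacter_mul_angle]
      ring
  have hsq : ∀ c : ℤ × ℤ → ℂ,
      HasSum (fun j => ∑ k ∈ S, ‖c k * x k j‖ ^ 2) (∑ k ∈ S, ‖c k‖ ^ 2) := fun c => by
    refine hasSum_sum fun k _ => ?_
    simpa [mul_pow] using (hx1 k).mul_left (‖c k‖ ^ 2)
  have hb := (((hsq a).add (hsq b)).div_const 2).mul_left (torusNorm θ f)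
  rw [← hsum.tsum_eq]
  exact tsum_of_norm_bounded hb fun j => norm_twistedForm_le θ hf S _ _

theorem torusNorm_le_add (θ η : ℝ) {f : ℤ × ℤ → ℂ} (hf : Summable fun n => ‖f n‖) :
    torusNorm (θ + η) f
      ≤ torusNorm θ f + ∑' n, ‖f n‖ * (1 - gaussianMultiplier η n) := by
  have hs : Summable fun n => ‖f n * gaussianMultiplier η n‖ := by
    refine Summable.of_nonneg_of_le (fun _ => norm_nonneg _) (fun n => ?_) hf
    rw [norm_mul, Complex.norm_real, Real.norm_of_nonneg (gaussianMultiplier_nonneg η n)]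
    exact mul_le_of_le_one_right (norm_nonneg _) (gaussianMultiplier_le_one η n)
  have h1 := (le_abs_self _).trans (abs_torusNorm_sub_le (θ + η) hf hs)
  have h2 := torusNorm_gaussianMultiplier_le θ η hf
  have h3 : ∀ n, ‖f n - f n * gaussianMultiplier η n‖ = ‖f n‖ * (1 - gaussianMultiplier η n) := by
    intro n
    rw [← mul_one_sub, norm_mul, ← Complex.ofReal_one, ← Complex.ofReal_sub, Complex.norm_real,
      Real.norm_of_nonneg (sub_nonneg.2 (gaussianMultiplier_le_one η n))]
  simp only [h3] at h1
  linarith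

/-- The one-sided estimate is used in both directions; the Gaussian factor depends only on `|η|`, so
the two errors agree. -/
theorem abs_torusNorm_angle_sub_le (θ θ' : ℝ) {f : ℤ × ℤ → ℂ} (hf : Summable fun n => ‖f n‖) :
    |torusNorm θ' f - torusNorm θ f| ≤ ∑' n, ‖f n‖ * (1 - gaussianMultiplier (θ' - θ) n) := by
  have h1 := torusNorm_le_add θ (θ' - θ) hf
  have h2 := torusNorm_le_add θ' (θ - θ') hf
  have h3 : gaussianMultiplier (θ - θ') = gaussianMultiplier (θ' - θ) := by
    funext n
    rw [gaussianMultiplier, gaussianMultiplier, abs_sub_comm]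
  rw [add_sub_cancel] at h1 h2
  rw [h3] at h2
  exact abs_le.2 ⟨by linarith, by linarith⟩

/-- The change of `f` at a fixed angle is controlled in `ℓ¹`, uniformly in the angle; the change of
angle is then needed only for the limit `f₀`. Both errors vanish by dominated convergence. -/
theorem tendsto_torusNorm {ι : Type*} {l : Filter ι} {θ : ι → ℝ} {θ₀ : ℝ}
    (hθ : Tendsto θ l (𝓝 θ₀)) {f : ι → ℤ × ℤ → ℂ} {f₀ : ℤ × ℤ → ℂ} {B : ℤ × ℤ → ℝ}
    (hB : Summable B) (hf : ∀ᶠ i in l, ∀ n, ‖f i n‖ ≤ B n) (hf₀ : ∀ n, ‖f₀ n‖ ≤ B n)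
    (hlim : ∀ n, Tendsto (fun i => f i n) l (𝓝 (f₀ n))) :
    Tendsto (fun i => torusNorm (θ i) (f i)) l (𝓝 (torusNorm θ₀ f₀)) := by
  have hs₀ : Summable fun n => ‖f₀ n‖ := Summable.of_nonneg_of_le (fun _ => norm_nonneg _) hf₀ hB
  have h1 : Tendsto (fun i => ∑' n, ‖f i n - f₀ n‖) l (𝓝 (∑' _ : ℤ × ℤ, (0 : ℝ))) := by
    refine tendsto_tsum_of_dominated_convergence (hB.add hB) (fun n => ?_) ?_
    · simpa using ((hlim n).sub_const (f₀ n)).norm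
    · filter_upwards [hf] with i hi n
      rw [norm_norm]
      exact (norm_sub_le _ _).trans (add_le_add (hi n) (hf₀ n))
  have h2 : Tendsto (fun i => ∑' n, ‖f₀ n‖ * (1 - gaussianMultiplier (θ i - θ₀) n)) l
      (𝓝 (∑' _ : ℤ × ℤ, (0 : ℝ))) := by
    refine tendsto_tsum_of_dominated_convergence hs₀ (fun n => ?_) (Eventually.of_forall ?_)
    · have hc : Continuous fun η => ‖f₀ n‖ * (1 - gaussianMultiplier η n) := by
        unfold gaussianMultiplier
        fun_prop
      have h0 : Tendsto (fun i => θ i - θ₀) l (𝓝 0) := by simpa using hθ.sub_const θ₀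
      simpa [gaussianMultiplier, Function.comp_def] using (hc.tendsto 0).comp h0
    · intro i n
      rw [Real.norm_of_nonneg (mul_nonneg (norm_nonneg _)
        (sub_nonneg.2 (gaussianMultiplier_le_one _ n)))]
      exact mul_le_of_le_one_right (norm_nonneg _)
        (sub_le_self _ (gaussianMultiplier_nonneg _ n))
  rw [tendsto_iff_norm_sub_tendsto_zero]
  refine squeeze_zero' (Eventually.of_forall fun _ => norm_nonneg _) ?_
    (by simpa using h1.add h2)
  filter_upwards [hf] with i hi
  have hs : Summable fun n => ‖f i n‖ := Summable.of_nonneg_of_le (fun _ => norm_nonneg _) hi hB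
  calc ‖torusNorm (θ i) (f i) - torusNorm θ₀ f₀‖
      ≤ |torusNorm (θ i) (f i) - torusNorm (θ i) f₀| + |torusNorm (θ i) f₀ - torusNorm θ₀ f₀| :=
        abs_sub_le _ _ _
    _ ≤ _ := add_le_add (abs_torusNorm_sub_le _ hs hs₀) (abs_torusNorm_angle_sub_le _ _ hs₀)

/-! ### The projective representations `ρ` and `ϖ` -/

theorem rho_mul (p : ℤ) {q d : ℕ} (hqd : q ∣ d) (x y : ℤ × ℤ) :
    rho p hqd x * rho p hqd y = skewBicharacter (p / q) x y • rho p hqd (x + y) := by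
  rw [rho, rho, rho, Matrix.submatrix_mul_equiv, ← Matrix.mul_kronecker_mul, rhoOne_mul, mul_one,
    Matrix.smul_kronecker]
  rfl

theorem conjTranspose_rhoOne_mul_self (p : ℤ) (q : ℕ) (n : ℤ × ℤ) :
    (rhoOne p q n)ᴴ * rhoOne p q n = 1 := by
  have h : Complex.I * Real.pi * p * n.1 * n.2 / q
      = ((Real.pi * p * n.1 * n.2 / q : ℝ) : ℂ) * Complex.I := by
    push_cast; ring
  rw [rhoOne, Matrix.conjTranspose_smul, smul_mul_smul_comm, ← Matrix.star_eq_conjTranspose,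
    Matrix.UnitaryGroup.star_mul_self, h, Complex.star_def, ← Complex.normSq_eq_conj_mul_self,
    Complex.normSq_eq_norm_sq, Complex.norm_exp_ofReal_mul_I]
  simp

theorem conjTranspose_rho_mul_self (p : ℤ) {q d : ℕ} (hqd : q ∣ d) (n : ℤ × ℤ) :
    (rho p hqd n)ᴴ * rho p hqd n = 1 := by
  rw [rho, Matrix.conjTranspose_submatrix, Matrix.submatrix_mul_equiv,
    Matrix.conjTranspose_kronecker, ← Matrix.mul_kronecker_mul, conjTranspose_rhoOne_mul_self]
  simp

theorem inner_toEuclideanLin_rho (p : ℤ) {q d : ℕ} (hqd : q ∣ d) (n : ℤ × ℤ)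
    (x y : EuclideanSpace ℂ (Fin d)) :
    inner ℂ (Matrix.toEuclideanLin (rho p hqd n) x) (Matrix.toEuclideanLin (rho p hqd n) y)
      = inner ℂ x y := by
  rw [← LinearMap.adjoint_inner_right, ← Matrix.toEuclideanLin_conjTranspose_eq_adjoint]
  congr 1
  have h := conjTranspose_rho_mul_self p hqd n
  simp only [Matrix.toLpLin_apply, Matrix.mulVec_mulVec, h, Matrix.one_mulVec]

/-- The isometry of `ℂ^d` given by the matrix `ρ_{p,q,d}^{n,m}`. -/
def rhoIsometry (p : ℤ) {q d : ℕ} (hqd : q ∣ d) (n : ℤ × ℤ) :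
    EuclideanSpace ℂ (Fin d) →ₗᵢ[ℂ] EuclideanSpace ℂ (Fin d) :=
  (Matrix.toEuclideanLin (rho p hqd n)).isometryOfInner (inner_toEuclideanLin_rho p hqd n)

theorem rhoIsometry_rhoIsometry (p : ℤ) {q d : ℕ} (hqd : q ∣ d) (x y : ℤ × ℤ)
    (v : EuclideanSpace ℂ (Fin d)) :
    rhoIsometry p hqd x (rhoIsometry p hqd y v)
      = skewBicharacter (p / q) x y • rhoIsometry p hqd (x + y) v := by
  have h := rho_mul p hqd x y
  change Matrix.toEuclideanLin (rho p hqd x) (Matrix.toEuclideanLin (rho p hqd y) v)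
    = skewBicharacter (p / q) x y • Matrix.toEuclideanLin (rho p hqd (x + y)) v
  simp only [Matrix.toLpLin_apply, Matrix.mulVec_mulVec, h, Matrix.smul_mulVec]
  rfl

section Varpi

variable (p : ℤ) {q d : ℕ} (hqd : q ∣ d) (θ : ℝ)

theorem varpi_eq (n : ℤ × ℤ) (ξ : ℝ → EuclideanSpace ℂ (Fin d)) (s : ℝ) :
    varpi p hqd θ n ξ s
      = Complex.exp (((Real.pi * (θ - p / q) * n.1 * n.2 + 2 * Real.pi * s * n.1 : ℝ) : ℂ)
          * Complex.I) • rhoIsometry p hqd n (ξ (s + (θ - p / q) * n.2)) := by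
  rw [varpi]
  congr 2
  push_cast
  ring

theorem inner_varpi_varpi (n : ℤ × ℤ) (ξ ω : ℝ → EuclideanSpace ℂ (Fin d)) (s : ℝ) :
    inner ℂ (varpi p hqd θ n ω s) (varpi p hqd θ n ξ s)
      = inner ℂ (ω (s + (θ - p / q) * n.2)) (ξ (s + (θ - p / q) * n.2)) := by
  rw [varpi_eq, varpi_eq, inner_smul_left, inner_smul_right, LinearIsometry.inner_map_map,
    ← mul_assoc, ← Complex.normSq_eq_conj_mul_self, Complex.normSq_eq_norm_sq,
    Complex.norm_exp_ofReal_mul_I]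
  simp

theorem norm_varpi (n : ℤ × ℤ) (ξ : ℝ → EuclideanSpace ℂ (Fin d)) (s : ℝ) :
    ‖varpi p hqd θ n ξ s‖ = ‖ξ (s + (θ - p / q) * n.2)‖ := by
  rw [varpi_eq, norm_smul, Complex.norm_exp_ofReal_mul_I, one_mul, LinearIsometry.norm_map]

theorem varpi_varpi (x y : ℤ × ℤ) (ξ : ℝ → EuclideanSpace ℂ (Fin d)) (s : ℝ) :
    varpi p hqd θ x (varpi p hqd θ y ξ) s
      = skewBicharacter θ x y • varpi p hqd θ (x + y) ξ s := by
  have hs : s + (θ - p / q) * x.2 + (θ - p / q) * y.2 = s + (θ - p / q) * ((x + y).2 : ℤ) := by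
    push_cast [Prod.snd_add]; ring
  rw [varpi_eq, varpi_eq, varpi_eq, map_smul, rhoIsometry_rhoIsometry, smul_smul, smul_smul,
    smul_smul, hs]
  congr 1
  simp only [skewBicharacter, ← Complex.exp_add, Prod.fst_add, Prod.snd_add]
  congr 1
  push_cast
  ring

theorem continuous_varpi (n : ℤ × ℤ) {ξ : ℝ → EuclideanSpace ℂ (Fin d)} (hξ : Continuous ξ) :
    Continuous (varpi p hqd θ n ξ) := by
  have h : varpi p hqd θ n ξ = fun s => _ := funext (varpi_eq p hqd θ n ξ)
  rw [h]
  have := (rhoIsometry p hqd n).continuous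
  fun_prop

/-- Translating the variable by `ð k₂` is undone by applying `ϖ^k` to both entries, and `ϖ^k ϖ^(m-k)
= σ_θ(k,m) ϖ^m` because `σ_θ(k,k) = 1`. -/
theorem heisenbergInner_mul_skewBicharacter (ξ ω : 𝓢(ℝ, EuclideanSpace ℂ (Fin d)))
    (m k : ℤ × ℤ) :
    heisenbergInner p hqd θ ξ ω (m - k) * skewBicharacter θ m k
      = ∫ s : ℝ, inner ℂ (varpi p hqd θ k ω s) (varpi p hqd θ m ξ s) := by
  have h : ∀ s, inner ℂ (ω (s + (θ - p / q) * k.2))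
      (varpi p hqd θ (m - k) ξ (s + (θ - p / q) * k.2))
      = skewBicharacter θ k m * inner ℂ (varpi p hqd θ k ω s) (varpi p hqd θ m ξ s) := fun s => by
    rw [← inner_varpi_varpi p hqd, varpi_varpi, inner_smul_right, add_sub_cancel]
    congr 1
    simp only [skewBicharacter, Prod.fst_sub, Prod.snd_sub]
    congr 1
    push_cast
    ring
  rw [heisenbergInner, ← MeasureTheory.integral_add_right_eq_self _ ((θ - p / q) * (k.2 : ℝ))]
  simp only [h]
  rw [MeasureTheory.integral_const_mul, mul_right_comm, skewBicharacter_mul_swap, one_mul]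

theorem memLp_varpi (n : ℤ × ℤ) (ξ : 𝓢(ℝ, EuclideanSpace ℂ (Fin d))) :
    MeasureTheory.MemLp (varpi p hqd θ n ξ) 2 := by
  have h := (ξ.memLp 2).comp_measurePreserving
    (MeasureTheory.measurePreserving_add_right MeasureTheory.volume ((θ - p / q) * (n.2 : ℝ)))
  exact h.of_le (continuous_varpi p hqd θ n ξ.continuous).aestronglyMeasurable
    (Eventually.of_forall fun s => (norm_varpi p hqd θ n ξ s).le)

/-- The function `ϖ^{n,m} ξ` as a vector of `L²(ℝ, ℂ^d)`. -/
def varpiLp (n : ℤ × ℤ) (ξ : 𝓢(ℝ, EuclideanSpace ℂ (Fin d))) :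
    MeasureTheory.Lp (EuclideanSpace ℂ (Fin d)) 2
      (MeasureTheory.volume : MeasureTheory.Measure ℝ) :=
  (memLp_varpi p hqd θ n ξ).toLp _

theorem inner_varpiLp (m k : ℤ × ℤ) (ξ ω : 𝓢(ℝ, EuclideanSpace ℂ (Fin d))) :
    inner ℂ (varpiLp p hqd θ k ω) (varpiLp p hqd θ m ξ)
      = heisenbergInner p hqd θ ξ ω (m - k) * skewBicharacter θ m k := by
  rw [heisenbergInner_mul_skewBicharacter, MeasureTheory.L2.inner_def]
  refine MeasureTheory.integral_congr_ae ?_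
  filter_upwards [(memLp_varpi p hqd θ k ω).coeFn_toLp, (memLp_varpi p hqd θ m ξ).coeFn_toLp]
    with s h1 h2
  rw [varpiLp, varpiLp, h1, h2]

theorem varpiLp_add (m : ℤ × ℤ) (ξ ω : 𝓢(ℝ, EuclideanSpace ℂ (Fin d))) :
    varpiLp p hqd θ m (ξ + ω) = varpiLp p hqd θ m ξ + varpiLp p hqd θ m ω := by
  rw [varpiLp, varpiLp, varpiLp, ← MeasureTheory.MemLp.toLp_add]
  congr 1
  funext s
  simp [varpi]

theorem twistedForm_heisenbergInner (ξ ω : 𝓢(ℝ, EuclideanSpace ℂ (Fin d)))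
    (S : Finset (ℤ × ℤ)) (a b : ℤ × ℤ → ℂ) :
    twistedForm θ (heisenbergInner p hqd θ ξ ω) S a b
      = inner ℂ (∑ k ∈ S, starRingEnd ℂ (a k) • varpiLp p hqd θ k ω)
          (∑ m ∈ S, starRingEnd ℂ (b m) • varpiLp p hqd θ m ξ) := by
  simp only [twistedForm, sum_inner, inner_sum, inner_smul_left, inner_smul_right, inner_varpiLp,
    Complex.conj_conj, Finset.mul_sum]
  refine Finset.sum_congr rfl fun k _ => Finset.sum_congr rfl fun m _ => ?_
  ring

/-! ### The Heisenberg norm as the norm of a synthesis map -/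

variable {θ} {ξ : 𝓢(ℝ, EuclideanSpace ℂ (Fin d))}

theorem norm_sum_varpiLp_le (hξ : Summable fun n => ‖heisenbergInner p hqd θ ξ ξ n‖)
    (S : Finset (ℤ × ℤ)) (c : ℤ × ℤ → ℂ) :
    ‖∑ m ∈ S, c m • varpiLp p hqd θ m ξ‖ ≤ heisenbergNorm p hqd θ ξ * √(∑ m ∈ S, ‖c m‖ ^ 2) := by
  have h := norm_twistedForm_le θ hξ S (fun k => starRingEnd ℂ (c k)) (fun k => starRingEnd ℂ (c k))
  rw [twistedForm_heisenbergInner] at h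
  simp only [Complex.conj_conj, RCLike.norm_conj, add_self_div_two, inner_self_eq_norm_sq_to_K,
    norm_pow] at h
  rw [heisenbergNorm, ← Real.sqrt_mul (torusNorm_nonneg _ _)]
  refine Real.le_sqrt_of_sq_le ?_
  simpa using h

theorem heisenbergNorm_le_of_norm_sum_varpiLp_le
    (hξ : Summable fun n => ‖heisenbergInner p hqd θ ξ ξ n‖) {C : ℝ} (hC : 0 ≤ C)
    (h : ∀ (S : Finset (ℤ × ℤ)) (c : ℤ × ℤ → ℂ),
      ‖∑ m ∈ S, c m • varpiLp p hqd θ m ξ‖ ≤ C * √(∑ m ∈ S, ‖c m‖ ^ 2)) :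
    heisenbergNorm p hqd θ ξ ≤ C := by
  rw [heisenbergNorm, Real.sqrt_le_left hC]
  refine torusNorm_le_of_twistedForm_le θ hξ (sq_nonneg C) fun S a b => ?_
  have hsq : ∀ c : ℤ × ℤ → ℂ, ‖∑ m ∈ S, starRingEnd ℂ (c m) • varpiLp p hqd θ m ξ‖ ^ 2
      ≤ C ^ 2 * ∑ m ∈ S, ‖c m‖ ^ 2 := fun c => by
    have h1 := pow_le_pow_left₀ (norm_nonneg _) (h S fun m => starRingEnd ℂ (c m)) 2
    rw [mul_pow, Real.sq_sqrt (by positivity)] at h1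
    simpa using h1
  rw [twistedForm_heisenbergInner]
  refine (norm_inner_le_norm _ _).trans ?_
  have ha := hsq a
  have hb := hsq b
  set u := ‖∑ m ∈ S, starRingEnd ℂ (a m) • varpiLp p hqd θ m ξ‖
  set v := ‖∑ m ∈ S, starRingEnd ℂ (b m) • varpiLp p hqd θ m ξ‖
  nlinarith [sq_nonneg (u - v)]

theorem heisenbergNorm_smul (c : ℂ) (ξ : 𝓢(ℝ, EuclideanSpace ℂ (Fin d))) :
    heisenbergNorm p hqd θ (c • ξ) = ‖c‖ * heisenbergNorm p hqd θ ξ := by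
  have h : heisenbergInner p hqd θ (c • ξ) (c • ξ)
      = fun n => (c * starRingEnd ℂ c) * heisenbergInner p hqd θ ξ ξ n := by
    funext n
    rw [heisenbergInner, heisenbergInner, ← MeasureTheory.integral_const_mul]
    refine MeasureTheory.integral_congr_ae (Eventually.of_forall fun s => ?_)
    simp only [varpi, smul_apply, map_smul, inner_smul_left, inner_smul_right]
    ring
  rw [heisenbergNorm, heisenbergNorm, h, torusNorm_const_mul, Complex.mul_conj,
    Complex.normSq_eq_norm_sq, Complex.norm_real, Real.norm_of_nonneg (sq_nonneg _),
    Real.sqrt_mul (sq_nonneg _), Real.sqrt_sq (norm_nonneg _)]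

theorem heisenbergNorm_zero : heisenbergNorm p hqd θ 0 = 0 := by
  simpa using heisenbergNorm_smul p hqd (θ := θ) 0 0

theorem heisenbergNorm_add_le
    (hs : ∀ ξ : 𝓢(ℝ, EuclideanSpace ℂ (Fin d)),
      Summable fun n => ‖heisenbergInner p hqd θ ξ ξ n‖)
    (ξ ω : 𝓢(ℝ, EuclideanSpace ℂ (Fin d))) :
    heisenbergNorm p hqd θ (ξ + ω) ≤ heisenbergNorm p hqd θ ξ + heisenbergNorm p hqd θ ω := by
  refine heisenbergNorm_le_of_norm_sum_varpiLp_le p hqd (hs _)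
    (add_nonneg (Real.sqrt_nonneg _) (Real.sqrt_nonneg _)) fun S c => ?_
  simp only [varpiLp_add, smul_add, Finset.sum_add_distrib, add_mul]
  exact (norm_add_le _ _).trans
    (add_le_add (norm_sum_varpiLp_le p hqd (hs ξ) S c) (norm_sum_varpiLp_le p hqd (hs ω) S c))

/-- The coefficient `c = δ₀` shows that `ϖ^0 ξ` vanishes in `L²`; being continuous it vanishes
everywhere, and its pointwise norm is that of `ξ`. -/
theorem eq_zero_of_heisenbergNorm_eq_zero
    (hξ : Summable fun n => ‖heisenbergInner p hqd θ ξ ξ n‖)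
    (h0 : heisenbergNorm p hqd θ ξ = 0) : ξ = 0 := by
  have h1 := norm_sum_varpiLp_le p hqd hξ {0} fun _ => 1
  rw [h0, zero_mul, Finset.sum_singleton, one_smul] at h1
  have h2 := norm_le_zero_iff.1 h1
  have h5 := (memLp_varpi p hqd θ 0 ξ).coeFn_toLp
  rw [← varpiLp, h2] at h5
  have h3 := ((continuous_varpi p hqd θ 0 ξ.continuous).ae_eq_iff_eq _ continuous_zero).1
    (h5.symm.trans (MeasureTheory.Lp.coeFn_zero _ _ _))
  ext1 s
  rw [zero_apply, ← norm_eq_zero]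
  have h4 := norm_varpi p hqd θ 0 ξ s
  rw [h3] at h4
  simpa using h4.symm

theorem isHeisenbergNorm_of_summable
    (hs : ∀ ξ : 𝓢(ℝ, EuclideanSpace ℂ (Fin d)),
      Summable fun n => ‖heisenbergInner p hqd θ ξ ξ n‖) :
    IsHeisenbergNorm p hqd θ where
  norm_nonneg _ := Real.sqrt_nonneg _
  norm_smul := heisenbergNorm_smul p hqd
  norm_triangle := heisenbergNorm_add_le p hqd hs
  norm_eq_zero_iff ξ :=
    ⟨eq_zero_of_heisenbergNorm_eq_zero p hqd (hs ξ), fun h => h ▸ heisenbergNorm_zero p hqd⟩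

end Varpi

/-! ### Decay of the inner product -/

section Decay

variable {E : Type*} [NormedAddCommGroup E] [InnerProductSpace ℂ E]

/-- The integral `∫ exp(iνs) ⟨A ξ(s + t), ω(s)⟩ ds`. -/
def oscillatoryPairing (ν t : ℝ) (A : E →ₗᵢ[ℂ] E) (ξ ω : ℝ → E) : ℂ :=
  ∫ s : ℝ, Complex.exp ((ν * s : ℝ) * Complex.I) * inner ℂ (ω s) (A (ξ (s + t)))

theorem norm_oscillatoryIntegrand (ν t : ℝ) (A : E →ₗᵢ[ℂ] E) (ξ ω : ℝ → E) (s : ℝ) :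
    ‖Complex.exp ((ν * s : ℝ) * Complex.I) * inner ℂ (ω s) (A (ξ (s + t)))‖
      ≤ ‖ω s‖ * ‖ξ (s + t)‖ := by
  rw [norm_mul, Complex.norm_exp_ofReal_mul_I, one_mul, ← A.norm_map (ξ (s + t))]
  exact norm_inner_le_norm _ _

theorem continuous_oscillatoryIntegrand (ν t : ℝ) (A : E →ₗᵢ[ℂ] E) {ξ ω : ℝ → E}
    (hξ : Continuous ξ) (hω : Continuous ω) :
    Continuous fun s : ℝ =>
      Complex.exp ((ν * s : ℝ) * Complex.I) * inner ℂ (ω s) (A (ξ (s + t))) := by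
  have := A.continuous
  fun_prop

/-- Both `s` and `s + t` cannot be small compared with `t`: the sum of the two denominators exceeds
`(4 + t²)/2` by `(2s + t)²/2`. The right side is integrable in `s` with an explicit factor decaying
in `t`. -/
theorem inv_one_add_sq_mul_le (s t : ℝ) :
    (1 + s ^ 2)⁻¹ * (1 + (s + t) ^ 2)⁻¹
      ≤ 2 / (4 + t ^ 2) * ((1 + s ^ 2)⁻¹ + (1 + (s + t) ^ 2)⁻¹) := by
  have h : (1 + s ^ 2)⁻¹ + (1 + (s + t) ^ 2)⁻¹
      = (1 + s ^ 2)⁻¹ * (1 + (s + t) ^ 2)⁻¹ * ((1 + s ^ 2) + (1 + (s + t) ^ 2)) := by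
    field_simp
    ring
  rw [h, mul_left_comm]
  refine le_mul_of_one_le_right (by positivity) ?_
  rw [div_mul_eq_mul_div, le_div_iff₀ (by positivity)]
  nlinarith [sq_nonneg (2 * s + t)]

theorem norm_oscillatoryPairing_le (ν t : ℝ) (A : E →ₗᵢ[ℂ] E) {ξ ω : ℝ → E} {M : ℝ}
    (hξ : ∀ s, ‖ξ s‖ ≤ M / (1 + s ^ 2)) (hω : ∀ s, ‖ω s‖ ≤ M / (1 + s ^ 2)) :
    ‖oscillatoryPairing ν t A ξ ω‖ ≤ 4 * Real.pi * M ^ 2 / (4 + t ^ 2) := by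
  have hI : MeasureTheory.Integrable fun s : ℝ => (1 + (s + t) ^ 2)⁻¹ :=
    integrable_inv_one_add_sq.comp_add_right t
  have hint : ∫ s : ℝ, M ^ 2 * (2 / (4 + t ^ 2)) * ((1 + s ^ 2)⁻¹ + (1 + (s + t) ^ 2)⁻¹)
      = 4 * Real.pi * M ^ 2 / (4 + t ^ 2) := by
    rw [MeasureTheory.integral_const_mul, MeasureTheory.integral_add integrable_inv_one_add_sq hI,
      MeasureTheory.integral_add_right_eq_self (fun s : ℝ => (1 + s ^ 2)⁻¹) t,
      integral_univ_inv_one_add_sq]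
    ring
  rw [← hint]
  refine MeasureTheory.norm_integral_le_of_norm_le
    ((integrable_inv_one_add_sq.add hI).const_mul _) (Eventually.of_forall fun s => ?_)
  refine (norm_oscillatoryIntegrand ν t A ξ ω s).trans ?_
  calc ‖ω s‖ * ‖ξ (s + t)‖ ≤ M / (1 + s ^ 2) * (M / (1 + (s + t) ^ 2)) :=
        mul_le_mul (hω s) (hξ _) (norm_nonneg _) ((norm_nonneg _).trans (hω s))
    _ = M ^ 2 * ((1 + s ^ 2)⁻¹ * (1 + (s + t) ^ 2)⁻¹) := by
        rw [div_eq_mul_inv, div_eq_mul_inv]; ring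
    _ ≤ _ := by
        rw [mul_assoc]
        exact mul_le_mul_of_nonneg_left (inv_one_add_sq_mul_le s t) (sq_nonneg M)

theorem integrable_oscillatoryIntegrand (ν t : ℝ) (A : E →ₗᵢ[ℂ] E) (ξ ω : 𝓢(ℝ, E)) :
    MeasureTheory.Integrable fun s : ℝ =>
      Complex.exp ((ν * s : ℝ) * Complex.I) * inner ℂ (ω s) (A (ξ (s + t))) := by
  refine (ω.integrable.norm.mul_const (SchwartzMap.seminorm ℝ 0 0 ξ)).mono'
    (continuous_oscillatoryIntegrand ν t A ξ.continuous ω.continuous).aestronglyMeasurable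
    (Eventually.of_forall fun s => ?_)
  exact (norm_oscillatoryIntegrand ν t A ξ ω s).trans
    (mul_le_mul_of_nonneg_left (SchwartzMap.norm_le_seminorm ℝ ξ _) (norm_nonneg _))

/-- Integration by parts: the integral over the line of the derivative of the integrand vanishes. -/
theorem oscillatoryPairing_deriv (ν t : ℝ) (A : E →ₗᵢ[ℂ] E) (ξ ω : 𝓢(ℝ, E)) :
    ν * Complex.I * oscillatoryPairing ν t A ξ ω
      = -(oscillatoryPairing ν t A (SchwartzMap.derivCLM ℝ E ξ) ω
        + oscillatoryPairing ν t A ξ (SchwartzMap.derivCLM ℝ E ω)) := by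
  have h0 := (integrable_oscillatoryIntegrand ν t A ξ ω).const_mul (ν * Complex.I)
  have h1 := integrable_oscillatoryIntegrand ν t A (SchwartzMap.derivCLM ℝ E ξ) ω
  have h2 := integrable_oscillatoryIntegrand ν t A ξ (SchwartzMap.derivCLM ℝ E ω)
  have hd : ∀ s : ℝ, HasDerivAt
      (fun s : ℝ => Complex.exp ((ν * s : ℝ) * Complex.I) * inner ℂ (ω s) (A (ξ (s + t))))
      (ν * Complex.I * (Complex.exp ((ν * s : ℝ) * Complex.I) * inner ℂ (ω s) (A (ξ (s + t))))
        + (Complex.exp ((ν * s : ℝ) * Complex.I)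
            * inner ℂ (ω s) (A (SchwartzMap.derivCLM ℝ E ξ (s + t)))
          + Complex.exp ((ν * s : ℝ) * Complex.I)
            * inner ℂ (SchwartzMap.derivCLM ℝ E ω s) (A (ξ (s + t))))) s := fun s => by
    have he : HasDerivAt (fun s : ℝ => Complex.exp ((ν * s : ℝ) * Complex.I))
        (Complex.exp ((ν * s : ℝ) * Complex.I) * (ν * Complex.I)) s := by
      have := (((hasDerivAt_id s).const_mul ν).ofReal_comp.mul_const Complex.I).cexp
      simpa using this
    have hA : HasDerivAt (fun s => A (ξ (s + t))) (A (deriv ξ (s + t))) s :=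
      (A.toContinuousLinearMap.restrictScalars ℝ).hasFDerivAt.comp_hasDerivAt s
        ((ξ.hasDerivAt (s + t)).comp_add_const s t)
    refine (he.mul ((ω.hasDerivAt s).inner ℂ hA)).congr_deriv ?_
    simp only [SchwartzMap.derivCLM_apply]
    ring
  have h := MeasureTheory.integral_eq_zero_of_hasDerivAt_of_integrable hd (h0.add (h1.add h2))
    (integrable_oscillatoryIntegrand ν t A ξ ω)
  have h12 := MeasureTheory.integral_add h1 h2
  have h012 := MeasureTheory.integral_add h0 (h1.add h2)
  simp only [Pi.add_apply] at h012
  rw [h012, h12, MeasureTheory.integral_const_mul] at h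
  exact eq_neg_of_add_eq_zero_left h

/-- The functions `ξ`, `ξ'`, `ξ''` are bounded by `M / (1 + t²)`. -/
def HasQuadraticDecay (M : ℝ) (ξ : ℝ → E) : Prop :=
  ∀ t : ℝ, ∀ s ≤ 2, ‖iteratedDeriv s ξ t‖ ≤ M / (1 + t ^ 2)

theorem exists_hasQuadraticDecay (ξ : 𝓢(ℝ, E)) : ∃ M : ℝ, 0 < M ∧ HasQuadraticDecay M ξ := by
  let c : ℕ → ℝ := fun s => SchwartzMap.seminorm ℝ 0 s ξ + SchwartzMap.seminorm ℝ 2 s ξ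
  have hc : ∀ s, 0 ≤ c s := fun s => add_nonneg (apply_nonneg _ _) (apply_nonneg _ _)
  have hsum : 0 ≤ ∑ s ∈ Finset.range 3, c s := Finset.sum_nonneg fun s _ => hc s
  refine ⟨1 + ∑ s ∈ Finset.range 3, c s, by positivity, fun t s hs => ?_⟩
  rw [le_div_iff₀ (by positivity)]
  have h0 := ξ.le_seminorm' ℝ 0 s t
  have h2 := ξ.le_seminorm' ℝ 2 s t
  rw [sq_abs] at h2
  have h3 : c s ≤ ∑ s ∈ Finset.range 3, c s :=
    Finset.single_le_sum (fun s _ => hc s) (Finset.mem_range.2 (by omega))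
  simp only [c] at h3 ⊢
  linarith

/-- Two integrations by parts write `ν²` times the pairing as four pairings of derivatives of total
order two. With the undifferentiated pairing this makes five terms, each at most `4πM²/(4 + t²)`. -/
theorem one_add_sq_mul_norm_oscillatoryPairing_le (ν t : ℝ) (A : E →ₗᵢ[ℂ] E) {ξ ω : 𝓢(ℝ, E)}
    {M : ℝ} (hξ : HasQuadraticDecay M ξ) (hω : HasQuadraticDecay M ω) :
    (1 + ν ^ 2) * ‖oscillatoryPairing ν t A ξ ω‖ ≤ 20 * Real.pi * M ^ 2 / (4 + t ^ 2) := by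
  set D := SchwartzMap.derivCLM ℝ E
  have key : ∀ {ξ : 𝓢(ℝ, E)}, HasQuadraticDecay M ξ → (∀ s, ‖ξ s‖ ≤ M / (1 + s ^ 2)) ∧
      (∀ s, ‖D ξ s‖ ≤ M / (1 + s ^ 2)) ∧ ∀ s, ‖D (D ξ) s‖ ≤ M / (1 + s ^ 2) := fun {ξ} h => by
    refine ⟨fun s => by simpa using h s 0 (by norm_num),
      fun s => by simpa [iteratedDeriv_one, D] using h s 1 (by norm_num), fun s => ?_⟩
    have := h s 2 le_rfl
    rwa [iteratedDeriv_succ, iteratedDeriv_one] at this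
  obtain ⟨a0, a1, a2⟩ := key hξ
  obtain ⟨b0, b1, b2⟩ := key hω
  have e0 := oscillatoryPairing_deriv ν t A ξ ω
  have e1 := oscillatoryPairing_deriv ν t A (D ξ) ω
  have e2 := oscillatoryPairing_deriv ν t A ξ (D ω)
  have e : ((ν ^ 2 : ℝ) : ℂ) * oscillatoryPairing ν t A ξ ω
      = -(oscillatoryPairing ν t A (D (D ξ)) ω + oscillatoryPairing ν t A (D ξ) (D ω)
        + (oscillatoryPairing ν t A (D ξ) (D ω) + oscillatoryPairing ν t A ξ (D (D ω)))) := by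
    push_cast
    linear_combination (-ν * Complex.I) * e0 + e1 + e2
      + ν ^ 2 * oscillatoryPairing ν t A ξ ω * Complex.I_sq
  have hn := congrArg norm e
  rw [norm_mul, Complex.norm_real, Real.norm_of_nonneg (sq_nonneg ν), norm_neg] at hn
  have n0 := norm_oscillatoryPairing_le ν t A a0 b0
  have n1 := norm_oscillatoryPairing_le ν t A a2 b0
  have n2 := norm_oscillatoryPairing_le ν t A a1 b1
  have n3 := norm_oscillatoryPairing_le ν t A a0 b2
  have m1 := norm_add_le (oscillatoryPairing ν t A (D (D ξ)) ω
    + oscillatoryPairing ν t A (D ξ) (D ω))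
    (oscillatoryPairing ν t A (D ξ) (D ω) + oscillatoryPairing ν t A ξ (D (D ω)))
  have m2 := norm_add_le (oscillatoryPairing ν t A (D (D ξ)) ω)
    (oscillatoryPairing ν t A (D ξ) (D ω))
  have m3 := norm_add_le (oscillatoryPairing ν t A (D ξ) (D ω))
    (oscillatoryPairing ν t A ξ (D (D ω)))
  rw [one_add_mul, hn, show 20 * Real.pi * M ^ 2 / (4 + t ^ 2)
    = 5 * (4 * Real.pi * M ^ 2 / (4 + t ^ 2)) by ring]
  linarith

end Decay

/-! ### Summability and convergence of Heisenberg inner products and norms -/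

theorem summable_inv_add_sq {c δ : ℝ} (hc : 0 < c) (hδ : δ ≠ 0) :
    Summable fun n : ℤ => (c + δ ^ 2 * (n : ℝ) ^ 2)⁻¹ := by
  have h := (Real.summable_one_div_int_pow.2 one_lt_two).mul_left (δ ^ 2)⁻¹
  refine Summable.of_norm_bounded_eventually h ?_
  rw [Filter.eventually_cofinite]
  refine (Set.finite_singleton (0 : ℤ)).subset fun n hn => ?_
  by_contra hn0
  refine hn ?_
  have hn0' : (n : ℝ) ≠ 0 := by exact_mod_cast hn0
  rw [Real.norm_of_nonneg (by positivity), one_div, ← mul_inv]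
  exact inv_anti₀ (by positivity) (by linarith)

theorem summable_inv_mul_inv {δ : ℝ} (hδ : δ ≠ 0) (K : ℝ) :
    Summable fun n : ℤ × ℤ =>
      K * ((1 + (1 : ℝ) ^ 2 * (n.1 : ℝ) ^ 2)⁻¹ * (4 + δ ^ 2 * (n.2 : ℝ) ^ 2)⁻¹) :=
  ((summable_inv_add_sq one_pos one_ne_zero).mul_of_nonneg
    (summable_inv_add_sq (by norm_num) hδ) (fun _ => by positivity)
    fun _ => by positivity).mul_left K

section HeisenbergInner

variable (p : ℤ) {q d : ℕ} (hqd : q ∣ d)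

theorem inner_varpi_eq (θ : ℝ) (ξ ω : ℝ → EuclideanSpace ℂ (Fin d)) (n : ℤ × ℤ) (s : ℝ) :
    inner ℂ (ω s) (varpi p hqd θ n ξ s)
      = Complex.exp ((Real.pi * (θ - p / q) * n.1 * n.2 : ℝ) * Complex.I)
        * (Complex.exp ((2 * Real.pi * n.1 * s : ℝ) * Complex.I)
          * inner ℂ (ω s) (rhoIsometry p hqd n (ξ (s + (θ - p / q) * n.2)))) := by
  rw [varpi_eq, inner_smul_right, ← mul_assoc, ← Complex.exp_add]
  congr 2
  push_cast
  ring

theorem heisenbergInner_eq (θ : ℝ) (ξ ω : 𝓢(ℝ, EuclideanSpace ℂ (Fin d))) (n : ℤ × ℤ) :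
    heisenbergInner p hqd θ ξ ω n
      = Complex.exp ((Real.pi * (θ - p / q) * n.1 * n.2 : ℝ) * Complex.I)
        * oscillatoryPairing (2 * Real.pi * n.1) ((θ - p / q) * n.2) (rhoIsometry p hqd n) ξ ω := by
  simp only [heisenbergInner, inner_varpi_eq, oscillatoryPairing]
  exact MeasureTheory.integral_const_mul _ _

/-- The parameter `δ` bounds `|ð|` from below, so a single summable majorant serves all angles that
stay away from `p/q`. -/
theorem norm_heisenbergInner_le {θ δ : ℝ} (hδ : |δ| ≤ |θ - p / q|)
    {ξ ω : 𝓢(ℝ, EuclideanSpace ℂ (Fin d))} {M : ℝ}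
    (hξ : HasQuadraticDecay M ξ) (hω : HasQuadraticDecay M ω) (n : ℤ × ℤ) :
    ‖heisenbergInner p hqd θ ξ ω n‖ ≤ 20 * Real.pi * M ^ 2 *
      ((1 + (1 : ℝ) ^ 2 * (n.1 : ℝ) ^ 2)⁻¹ * (4 + δ ^ 2 * (n.2 : ℝ) ^ 2)⁻¹) := by
  rw [heisenbergInner_eq, norm_mul, Complex.norm_exp_ofReal_mul_I, one_mul]
  have h := one_add_sq_mul_norm_oscillatoryPairing_le (2 * Real.pi * n.1) ((θ - p / q) * n.2)
    (rhoIsometry p hqd n) hξ hω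
  rw [← le_div_iff₀' (by positivity)] at h
  refine h.trans ?_
  rw [div_div, div_eq_mul_inv, mul_inv, mul_comm (_)⁻¹]
  have h1 : 1 + (1 : ℝ) ^ 2 * (n.1 : ℝ) ^ 2 ≤ 1 + (2 * Real.pi * n.1) ^ 2 := by
    have hpi : (1 : ℝ) ≤ 2 * Real.pi := by linarith [Real.pi_gt_three]
    rw [mul_pow]
    gcongr
  have h2 : 4 + δ ^ 2 * (n.2 : ℝ) ^ 2 ≤ 4 + ((θ - p / q) * n.2) ^ 2 := by
    rw [mul_pow]
    have := sq_le_sq.2 hδ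
    gcongr
  gcongr

theorem summable_heisenbergInner {θ : ℝ} (hθ : θ - p / q ≠ 0)
    (ξ ω : 𝓢(ℝ, EuclideanSpace ℂ (Fin d))) :
    Summable fun n => ‖heisenbergInner p hqd θ ξ ω n‖ := by
  obtain ⟨M, hM, hξ⟩ := exists_hasQuadraticDecay ξ
  obtain ⟨N, hN, hω⟩ := exists_hasQuadraticDecay ω
  have hξ' : HasQuadraticDecay (max M N) ξ := fun t s hs =>
    (hξ t s hs).trans (by gcongr; exact le_max_left _ _)
  have hω' : HasQuadraticDecay (max M N) ω := fun t s hs =>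
    (hω t s hs).trans (by gcongr; exact le_max_right _ _)
  exact Summable.of_nonneg_of_le (fun _ => norm_nonneg _)
    (norm_heisenbergInner_le p hqd le_rfl hξ' hω') (summable_inv_mul_inv hθ _)

theorem isHeisenbergNorm {θ : ℝ} (hθ : θ - p / q ≠ 0) : IsHeisenbergNorm p hqd θ :=
  isHeisenbergNorm_of_summable p hqd fun ξ => summable_heisenbergInner p hqd hθ ξ ξ

/-- Convergence along moving points is assumed because the argument `s + ð m` varies with the angle.
A general countably generated filter covers both sequences and neighbourhoods of an angle. -/
theorem tendsto_heisenbergInner {ι : Type*} {l : Filter ι} [l.IsCountablyGenerated]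
    {θ : ι → ℝ} {θ₀ : ℝ} {ξ : ι → 𝓢(ℝ, EuclideanSpace ℂ (Fin d))}
    {ξ₀ : 𝓢(ℝ, EuclideanSpace ℂ (Fin d))} {M : ℝ}
    (hθ : Tendsto θ l (𝓝 θ₀)) (hM : ∀ i, HasQuadraticDecay M (ξ i))
    (hξ : ∀ (t : ι → ℝ) (t₀ : ℝ), Tendsto t l (𝓝 t₀) →
      Tendsto (fun i => ξ i (t i)) l (𝓝 (ξ₀ t₀))) (n : ℤ × ℤ) :
    Tendsto (fun i => heisenbergInner p hqd (θ i) (ξ i) (ξ i) n) l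
      (𝓝 (heisenbergInner p hqd θ₀ ξ₀ ξ₀ n)) := by
  have hM0 : ∀ i s, ‖ξ i s‖ ≤ M / (1 + s ^ 2) := fun i s => by simpa using hM i s 0 (by norm_num)
  have hMn : ∀ i, ∀ s : ℝ, ‖ξ i s‖ ≤ M := fun i s => by
    refine (hM0 i s).trans (div_le_self ?_ (by nlinarith [sq_nonneg s]))
    have := (norm_nonneg _).trans (hM0 i 0)
    simpa using this
  refine MeasureTheory.tendsto_integral_filter_of_dominated_convergence
    (fun s : ℝ => M * M * (1 + s ^ 2)⁻¹) (Eventually.of_forall fun i => ?_)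
    (Eventually.of_forall fun i => Eventually.of_forall fun s => ?_)
    (integrable_inv_one_add_sq.const_mul _) (Eventually.of_forall fun s => ?_)
  · exact ((ξ i).continuous.inner
      (continuous_varpi p hqd (θ i) n (ξ i).continuous)).aestronglyMeasurable
  · refine (norm_inner_le_norm _ _).trans ?_
    rw [norm_varpi]
    calc ‖ξ i s‖ * ‖ξ i (s + (θ i - p / q) * n.2)‖ ≤ M / (1 + s ^ 2) * M :=
          mul_le_mul (hM0 i s) (hMn i _) (norm_nonneg _) ((norm_nonneg _).trans (hM0 i s))
      _ = M * M * (1 + s ^ 2)⁻¹ := by rw [div_eq_mul_inv]; ring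
  · have hs := hξ _ _ (tendsto_const_nhds (x := s))
    have ht : Tendsto (fun i => s + (θ i - p / q) * n.2) l (𝓝 (s + (θ₀ - p / q) * n.2)) :=
      ((hθ.sub_const _).mul_const _).const_add s
    have hA := ((rhoIsometry p hqd n).continuous.tendsto _).comp (hξ _ _ ht)
    have hc : Continuous fun θ : ℝ => Complex.exp
        (((Real.pi * (θ - p / q) * n.1 * n.2 + 2 * Real.pi * s * n.1 : ℝ) : ℂ) * Complex.I) := by
      fun_prop
    simp only [varpi_eq]
    exact hs.inner (((hc.tendsto θ₀).comp hθ).smul hA)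

theorem tendsto_heisenbergNorm {ι : Type*} {l : Filter ι} [l.IsCountablyGenerated]
    {θ : ι → ℝ} {θ₀ : ℝ} {ξ : ι → 𝓢(ℝ, EuclideanSpace ℂ (Fin d))}
    {ξ₀ : 𝓢(ℝ, EuclideanSpace ℂ (Fin d))} {M : ℝ} (hθ₀ : θ₀ - p / q ≠ 0)
    (hθ : Tendsto θ l (𝓝 θ₀)) (hM : ∀ i, HasQuadraticDecay M (ξ i)) (hM₀ : HasQuadraticDecay M ξ₀)
    (hξ : ∀ (t : ι → ℝ) (t₀ : ℝ), Tendsto t l (𝓝 t₀) →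
      Tendsto (fun i => ξ i (t i)) l (𝓝 (ξ₀ t₀))) :
    Tendsto (fun i => heisenbergNorm p hqd (θ i) (ξ i)) l
      (𝓝 (heisenbergNorm p hqd θ₀ ξ₀)) := by
  -- Half the limiting `ð` is a lower bound for nearby angles and is still nonzero, which keeps the
  -- majorant summable.
  have hδ : |(θ₀ - p / q) / 2| < |θ₀ - p / q| := by
    rw [abs_div, abs_two]
    linarith [abs_pos.2 hθ₀]
  have hev : ∀ᶠ i in l, |(θ₀ - p / q) / 2| ≤ |θ i - p / q| :=
    ((hθ.sub_const _).abs.eventually (lt_mem_nhds hδ)).mono fun _ h => h.le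
  refine (tendsto_torusNorm hθ
    (summable_inv_mul_inv (div_ne_zero hθ₀ two_ne_zero) (20 * Real.pi * M ^ 2)) ?_
    (norm_heisenbergInner_le p hqd hδ.le hM₀ hM₀)
    (tendsto_heisenbergInner p hqd hθ hM hξ)).sqrt
  filter_upwards [hev] with i hi n
  exact norm_heisenbergInner_le p hqd hi (hM i) (hM i) n

theorem continuous_heisenbergNorm (ξ : 𝓢(ℝ, EuclideanSpace ℂ (Fin d))) :
    Continuous fun θ : {θ : ℝ // θ - (p : ℝ) / q ≠ 0} => heisenbergNorm p hqd (θ : ℝ) ξ := by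
  obtain ⟨M, -, hM⟩ := exists_hasQuadraticDecay ξ
  refine continuous_iff_continuousAt.2 fun θ => ?_
  exact tendsto_heisenbergNorm p hqd θ.2 (continuous_subtype_val.tendsto θ) (fun _ => hM) hM
    fun t t₀ ht => (ξ.continuous.tendsto t₀).comp ht

end HeisenbergInner

/-! ### Continuous fields generated by a space of sections -/

section ContinuousField

variable {X : Type*} [TopologicalSpace X] {E : X → Type*}
  [∀ x, NormedAddCommGroup (E x)] [∀ x, NormedSpace ℂ (E x)]

/-- The sections that are locally uniform limits of sections in `Λ`. -/
def localUniformClosure (Λ : Submodule ℂ (∀ x, E x)) : Submodule ℂ (∀ x, E x) where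
  carrier := {s | ∀ x, ∀ ε > 0, ∃ s' ∈ Λ, ∀ᶠ y in 𝓝 x, ‖s y - s' y‖ ≤ ε}
  add_mem' {s t} hs ht x ε hε := by
    obtain ⟨s', hs', h1⟩ := hs x (ε / 2) (half_pos hε)
    obtain ⟨t', ht', h2⟩ := ht x (ε / 2) (half_pos hε)
    refine ⟨s' + t', Λ.add_mem hs' ht', ?_⟩
    filter_upwards [h1, h2] with y h1 h2
    rw [Pi.add_apply, Pi.add_apply, add_sub_add_comm]
    exact (norm_add_le _ _).trans (by linarith)
  zero_mem' x ε hε := ⟨0, Λ.zero_mem, Eventually.of_forall fun y => by simpa using hε.le⟩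
  smul_mem' c s hs x ε hε := by
    obtain ⟨s', hs', h⟩ := hs x (ε / (‖c‖ + 1)) (by positivity)
    refine ⟨c • s', Λ.smul_mem c hs', ?_⟩
    filter_upwards [h] with y h
    rw [Pi.smul_apply, Pi.smul_apply, ← smul_sub, norm_smul]
    rw [le_div_iff₀ (by positivity)] at h
    nlinarith [norm_nonneg (s y - s' y)]

theorem le_localUniformClosure (Λ : Submodule ℂ (∀ x, E x)) : Λ ≤ localUniformClosure Λ :=
  fun s hs _ _ hε => ⟨s, hs, Eventually.of_forall fun y => by simpa using hε.le⟩

variable [∀ x, CompleteSpace (E x)] {Λ : Submodule ℂ (∀ x, E x)}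

theorem isContinuousField_localUniformClosure
    (hdense : ∀ x, Dense {e : E x | ∃ s ∈ Λ, s x = e})
    (hnorm : ∀ s ∈ Λ, Continuous fun x => ‖s x‖) :
    IsContinuousField (localUniformClosure Λ) where
  dense_eval x := by
    refine (hdense x).mono ?_
    rintro _ ⟨s, hs, rfl⟩
    exact ⟨s, le_localUniformClosure Λ hs, rfl⟩
  continuous_norm s hs := by
    refine continuous_iff_continuousAt.2 fun x => Metric.tendsto_nhds.2 fun ε hε => ?_
    obtain ⟨s', hs', h⟩ := hs x (ε / 4) (by positivity)
    have hc := Metric.tendsto_nhds.1 ((hnorm s' hs').tendsto x) (ε / 4) (by positivity)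
    have hx := h.self_of_nhds
    filter_upwards [h, hc] with y hy hcy
    rw [Real.dist_eq] at hcy ⊢
    have h1 := abs_le.1 ((abs_norm_sub_norm_le (s y) (s' y)).trans hy)
    have h2 := abs_le.1 ((abs_norm_sub_norm_le (s x) (s' x)).trans hx)
    have h3 := abs_lt.1 hcy
    exact abs_lt.2 ⟨by linarith, by linarith⟩
  mem_of_locally_approx s hs x ε hε := by
    obtain ⟨t, ht, h1⟩ := hs x (ε / 2) (half_pos hε)
    obtain ⟨u, hu, h2⟩ := ht x (ε / 2) (half_pos hε)
    refine ⟨u, hu, ?_⟩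
    filter_upwards [h1, h2] with y h1 h2
    exact (norm_sub_le_norm_sub_add_norm_sub _ (t y) _).trans (by linarith)

/-- A section of `Γ` is approximated at one point by some `s'` in `Λ`; continuity of the norm of the
difference, itself in `Γ`, spreads the approximation to a neighbourhood. The reverse inclusion is
the closure axiom. -/
theorem IsContinuousField.eq_localUniformClosure {Γ : Submodule ℂ (∀ x, E x)}
    (hΓ : IsContinuousField Γ) (hΛ : Λ ≤ Γ)
    (hdense : ∀ x, Dense {e : E x | ∃ s ∈ Λ, s x = e}) : Γ = localUniformClosure Λ := by
  refine le_antisymm (fun s hs x ε hε => ?_) fun s hs => hΓ.mem_of_locally_approx s fun x ε hε => ?_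
  · obtain ⟨_, he, s', hs', rfl⟩ := Metric.dense_iff.1 (hdense x) (s x) ε hε
    refine ⟨s', hs', ?_⟩
    have hc := (hΓ.continuous_norm _ (Γ.sub_mem hs (hΛ hs'))).tendsto x
    rw [Metric.mem_ball, dist_comm, dist_eq_norm] at he
    exact (hc.eventually (gt_mem_nhds he)).mono fun y hy => hy.le
  · obtain ⟨s', hs', h⟩ := hs x ε hε
    exact ⟨s', hΛ hs', h⟩

end ContinuousField

/-- The space of constant sections of the field of Heisenberg modules. -/
def constantSections (p : ℤ) {q d : ℕ} (hqd : q ∣ d)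
    (h : ∀ θ : {θ : ℝ // θ - (p : ℝ) / q ≠ 0}, IsHeisenbergNorm p hqd (θ : ℝ)) :
    Submodule ℂ (∀ θ : {θ : ℝ // θ - (p : ℝ) / q ≠ 0}, HeisenbergModule (h θ)) where
  carrier := Set.range fun (ξ : 𝓢(ℝ, EuclideanSpace ℂ (Fin d))) θ =>
    HeisenbergModule.ofSchwartz (h θ) ξ
  add_mem' := by
    rintro _ _ ⟨ξ, rfl⟩ ⟨ω, rfl⟩
    exact ⟨ξ + ω, funext fun θ =>
      UniformSpace.Completion.coe_add (α := NormedPreHeisenbergModule (h θ)) ξ ω⟩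
  zero_mem' := ⟨0, funext fun θ =>
    UniformSpace.Completion.coe_zero (α := NormedPreHeisenbergModule (h θ))⟩
  smul_mem' := by
    rintro c _ ⟨ξ, rfl⟩
    exact ⟨c • ξ, funext fun θ =>
      UniformSpace.Completion.coe_smul (X := NormedPreHeisenbergModule (h θ)) c ξ⟩

theorem dense_eval_constantSections (p : ℤ) {q d : ℕ} (hqd : q ∣ d)
    (h : ∀ θ : {θ : ℝ // θ - (p : ℝ) / q ≠ 0}, IsHeisenbergNorm p hqd (θ : ℝ))
    (θ : {θ : ℝ // θ - (p : ℝ) / q ≠ 0}) :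
    Dense {e : HeisenbergModule (h θ) | ∃ s ∈ constantSections p hqd h, s θ = e} := by
  refine (UniformSpace.Completion.denseRange_coe
    (α := NormedPreHeisenbergModule (h θ))).mono ?_
  rintro _ ⟨ξ, rfl⟩
  exact ⟨_, ⟨ξ, rfl⟩, rfl⟩

end

theorem mainTheorem5 (p : ℤ) (q d : ℕ) (hqd : q ∣ d) (hd : 0 < d) :
    (∀ θ : ℝ, θ - (p : ℝ) / q ≠ 0 → ∀ ξ ω : 𝓢(ℝ, EuclideanSpace ℂ (Fin d)),
      Memℓp (heisenbergInner p hqd θ ξ ω) 1) ∧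
    (∀ (ξ : OnePoint ℕ → 𝓢(ℝ, EuclideanSpace ℂ (Fin d))) (θ : OnePoint ℕ → ℝ),
      Continuous (fun z : OnePoint ℕ × ℝ => ξ z.1 z.2) →
      (∃ M : ℝ, 0 < M ∧ ∀ (k : OnePoint ℕ) (t : ℝ), ∀ s ≤ 2,
        ‖iteratedDeriv s (ξ k) t‖ ≤ M / (1 + t ^ 2)) →
      Tendsto (fun k : ℕ => θ k) atTop (𝓝 (θ OnePoint.infty)) →
      (∀ k : OnePoint ℕ, θ k - (p : ℝ) / q ≠ 0) →
      Tendsto (fun k : ℕ => heisenbergNorm p hqd (θ k) (ξ k)) atTop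
        (𝓝 (heisenbergNorm p hqd (θ OnePoint.infty) (ξ OnePoint.infty)))) ∧
    ∃ h : ∀ θ : {θ : ℝ // θ - (p : ℝ) / q ≠ 0}, IsHeisenbergNorm p hqd (θ : ℝ),
      ∃! Γ : Submodule ℂ (∀ θ : {θ : ℝ // θ - (p : ℝ) / q ≠ 0}, HeisenbergModule (h θ)),
        IsContinuousField Γ ∧
        ∀ ξ : 𝓢(ℝ, EuclideanSpace ℂ (Fin d)),
          (fun θ => HeisenbergModule.ofSchwartz (h θ) ξ) ∈ Γ := by
  refine ⟨fun θ hθ ξ ω => ?_, fun ξ θ hξ ⟨M, _, hM⟩ hθ hne => ?_, ?_⟩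
  · refine memℓp_gen ?_
    simpa using summable_heisenbergInner p hqd hθ ξ ω
  · refine tendsto_heisenbergNorm p hqd (hne _) hθ (fun k => hM k) (hM OnePoint.infty)
      fun t t₀ ht => ?_
    have hk : Tendsto (fun k : ℕ => (k : OnePoint ℕ)) atTop (𝓝 OnePoint.infty) := by
      have := OnePoint.tendsto_coe_infty (X := ℕ)
      rwa [coclosedCompact_eq_cocompact, cocompact_eq_cofinite, Nat.cofinite_eq_atTop] at this
    -- Joint continuity at `(∞, t₀)` is precisely convergence along moving points.
    exact (hξ.tendsto (OnePoint.infty, t₀)).comp (hk.prodMk_nhds ht)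
  · refine ⟨fun θ => isHeisenbergNorm p hqd θ.2, localUniformClosure (constantSections p hqd _),
      ⟨isContinuousField_localUniformClosure (dense_eval_constantSections p hqd _) ?_,
        fun ξ => le_localUniformClosure _ ⟨ξ, rfl⟩⟩, fun Γ hΓ => ?_⟩
    · rintro _ ⟨ξ, rfl⟩
      simpa only [HeisenbergModule.norm_ofSchwartz] using continuous_heisenbergNorm p hqd ξ
    · refine hΓ.1.eq_localUniformClosure ?_ (dense_eval_constantSections p hqd _)
      rintro _ ⟨ξ, rfl⟩
      exact hΓ.2 ξ
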